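/- Fix a set $I$ of internal actions, a disjoint set $E$ of external actions and a silent action $\tau\notin I\cup E$; put $\Sigma_\tau=\{\tau\}\cup I\cup E$. For a set $X$ let $\mathcal D(X)$ be the set of finitely supported probability distributions on $X$, and $\delta_x$ the point distribution at $x$. A probabilistic automaton is a tuple $P=(P,\to_P,\mu_0^P,F_P)$ with a set $P$ of states, a transition relation $\to_P\,\subseteq P\times\Sigma_\tau\times\mathcal D(P)$, an initial distribution $\mu_0^P\in\mathcal D(P)$ and a set $F_P\subseteq P$ of final states. Let $\mathbf{PAut}$ be the collection of these automata (with states in a fixed universe). The operations are, with disjoint state spaces, a fresh state $z$, and distributions on a part regarded as distributions on the whole: - $\mathbf 0=(\{x\},\emptyset,\delta_x,\emptyset)$ (deadlock) and $\mathbf 1=(\{x\},\emptyset,\delta_x,\{x\})$ (skip); - $P+Q=(P\cup Q\cup\{z\},\ \to_P\cup\to_Q\cup\{z\xrightarrow{\tau}\mu_0^P,\ z\xrightarrow{\tau}\mu_0^Q\},\ \delta_z,\ F_P\cup F_Q)$; - $P\cdot Q=(P\cup Q,\ \to_P\cup\to_Q\cup\{x\xrightarrow{\tau}\mu_0^Q\mid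 x\in F_P\},\ \mu_0^P,\ F_Q)$; - $P^*=(P\cup\{z\},\ \to_P\cup\{z\xrightarrow{\tau}\mu_0^P\}\cup\{x\xrightarrow{\tau}\delta_z\mid x\in F_P\},\ \delta_z,\ \{z\})$; - $P\oplus_p Q=(P\cup Q,\ \to_P\cup\to_Q,\ p\mu_0^P+(1-p)\mu_0^Q,\ F_P\cup F_Q)$ for $p\in[0,1]$; - $P\|Q=(P\times Q,\to,\mu_0^P\times\mu_0^Q,F_P\times F_Q)$, where $(x,y)\xrightarrow{a}\mu\times\nu$ iff either $a\in E$, $x\xrightarrow{a}\mu$ and $y\xrightarrow{a}\nu$; or $a\notin E$, $x\xrightarrow{a}\mu$ and $\nu=\delta_y$; or $a\notin E$, $y\xrightarrow{a}\nu$ and $\mu=\delta_x$. For $S\subseteq X\times\mathcal D(Y)$ write $\mu\,\overline S\,\nu$ if there are a finite family of numbers $p_n\in[0,1]$ with $\sum_n p_n=1$, points $x_n\in X$ and $\nu_n\in\mathcal D(Y)$ with $x_n\,S\,\nu_n$ for all $n$, $\mu=\sum_n p_n\delta_{x_n}$ and $\nu=\sum_n p_n\nu_n$. For weak transitions, the relation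 $\xrightarrow{\tau}$ is first extended by all pairs $(x,\delta_x)$; $\overline a$ denotes the lifting of $\xrightarrow{a}$; $\Rightarrow$ is the reflexive transitive closure of $\overline\tau$, and $\mu\stackrel{a}{\Rightarrow}\mu'$ means $\mu\Rightarrow\mu_1\mathrel{\overline a}\mu_2\Rightarrow\mu'$ for some $\mu_1,\mu_2$. A probabilistic (weak) simulation from $P$ to $Q$ is a relation $S\subseteq P\times\mathcal D(Q)$ such that (1) $\mu_0^P\,\overline S\,\nu_0'$ and $\mu_0^Q\Rightarrow\nu_0'$ for some $\nu_0'$; (2) if $x\xrightarrow{a}\mu'$ is a transition of $P$ and $x\,S\,\nu$, then $\nu\stackrel{a}{\Rightarrow}\nu'$ and $\mu'\,\overline S\,\nu'$ for some $\nu'$; (3) if $x\in F_P$ and $x\,S\,\nu$, then $\nu\Rightarrow\nu'$ for some $\nu'$ with support contained in $F_Q$. Write $P\le Q$ if there is a simulation from $P$ to $Q$, and $P\equiv Q$ if $P\le Q$ and $Q\le P$. **Theorem.** The relation $\equiv$ is an equivalence relation on $\mathbf{PAut}$, all the operations above are well defined on $\mathbf{PAut}/{\equiv}$, and $P\le Q$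 if and only if $P+Q\equiv Q$. With the induced operations, $\mathbf{PAut}/{\equiv}$ is a weak concurrent Kleene algebra, and with the choices $\oplus_p$ it is a probabilistic concurrent Kleene algebra. That is, for all $P,Q,R,P',Q'$ and all $p\in[0,1]$, the weak concurrent Kleene algebra laws hold: - $P\equiv P+P$, $\ P\equiv P+\mathbf 0$, $\ P+Q\equiv Q+P$, $\ P+(Q+R)\equiv(P+Q)+R$; - $P\equiv P\cdot\mathbf 1$, $\ P\equiv\mathbf 1\cdot P$, $\ \mathbf 0\equiv\mathbf 0\cdot P$, $\ P\cdot(Q\cdot R)\equiv(P\cdot Q)\cdot R$, $\ P\cdot R+Q\cdot R\equiv(P+Q)\cdot R$, $\ P\cdot Q+P\cdot R\le P\cdot(Q+R)$; - $P^*\equiv\mathbf 1+P\cdot P^*$, and $P\cdot Q\le Q$ implies $P^*\cdot Q\le Q$; - $P\|Q\equiv Q\|P$, $\ P\|(Q\|R)\equiv(P\|Q)\|R$, $\ (P\|Q)\cdot(P'\|Q')\le(P\cdot P')\|(Q\cdot Q')$, $\ (P\|Q)+(P\|R)\le P\|(Q+R)$; and so do the probabilistic laws: - $P\equiv P\oplus_pP$,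 $\ P\oplus_pQ\equiv Q\oplus_{1-p}P$, and $P\oplus_p(Q\oplus_qR)\equiv(P\oplus_{p'}Q)\oplus_{q'}R$ whenever $p,q,p',q'\in[0,1]$ satisfy $p'q'=p$, $(1-p')q'=(1-p)q$ and $1-q'=(1-p)(1-q)$; - $(P\oplus_pQ)\cdot R\equiv(P\cdot R)\oplus_p(Q\cdot R)$, $\ P\cdot(Q\oplus_pR)\le(P\cdot Q)\oplus_p(P\cdot R)$, $\ (P\|Q)\oplus_p(P\|R)\equiv P\|(Q\oplus_pR)$. -/

import Mathlib

universe u v w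

noncomputable section

/-- `FinDist X` is the set of finitely supported probability distributions over `X`. The point
distribution at `x` is `Convexity.StdSimplex.single x`, the image of `μ` under `f` is `μ.map f`, and
`Convexity.iConvexComb p ν` is the distribution `∑ i, p i • ν i`. -/
abbrev FinDist (X : Type u) : Type u := Convexity.StdSimplex ℝ X

namespace FinDist

/-- The point distribution at `x`. -/
abbrev dirac {X : Type u} (x : X) : FinDist X := Convexity.StdSimplex.single x

/-- The product distribution: `(μ × ν) (x, y) = μ x * ν y`. -/
def prod {X : Type u} {Y : Type v} (μ : FinDist X) (ν : FinDist Y) : FinDist (X × Y) where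
  weights := Finsupp.onFinset (μ.weights.support ×ˢ ν.weights.support)
    (fun t => μ.weights t.1 * ν.weights t.2) (by
      intro t ht
      rw [Finset.mem_product, Finsupp.mem_support_iff, Finsupp.mem_support_iff]
      exact ⟨left_ne_zero_of_mul ht, right_ne_zero_of_mul ht⟩)
  nonneg := by
    rw [Finsupp.le_def]
    intro t
    exact mul_nonneg (Convexity.StdSimplex.weights_nonneg t.1)
      (Convexity.StdSimplex.weights_nonneg t.2)
  total := by
    rw [Finsupp.onFinset_sum _ (fun _ => rfl), Finset.sum_product]
    have hν : ∑ y ∈ ν.weights.support, ν.weights y = 1 := ν.total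
    have hμ : ∑ x ∈ μ.weights.support, μ.weights x = 1 := μ.total
    simp only [← Finset.mul_sum, hν, mul_one, hμ]

/-- The distribution `p • μ + (1 - p) • ν`. -/
def mix {X : Type u} (p : unitInterval) (μ ν : FinDist X) : FinDist X :=
  Convexity.convexCombPair (p : ℝ) (1 - p) p.2.1 (sub_nonneg.2 p.2.2) (by ring) μ ν

/-- Lifting of a relation `S ⊆ X × FinDist Y` to a relation between distributions:
`μ = ∑ i, p i • δ (x i)` and `ν = ∑ i, p i • ν' i`, where `S (x i) (ν' i)` for every index `i`. -/
def Lift {X : Type u} {Y : Type v} (S : X → FinDist Y → Prop) (μ : FinDist X) (ν : FinDist Y) : Prop :=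
  ∃ (n : ℕ) (p : FinDist (Fin n)) (x : Fin n → X) (ν' : Fin n → FinDist Y),
    μ = Convexity.iConvexComb p (fun i => dirac (x i)) ∧
    (∀ i, S (x i) (ν' i)) ∧
    ν = Convexity.iConvexComb p ν'

end FinDist

/-- The set of actions `Σ_τ`: the silent action, the internal actions `I` and the external
actions `E`. -/
inductive Act (I : Type v) (E : Type w) : Type (max v w)
  | tau : Act I E
  | internal (i : I) : Act I E
  | external (e : E) : Act I E

/-- Probabilistic automata over the internal actions `I` and the external actions `E`. -/
structure PAut (I : Type v) (E : Type w) : Type (max (u + 1) v w) where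
  State : Type u
  trans : State → Act I E → FinDist State → Prop
  init : FinDist State
  final : Set State

namespace PAut

variable {I : Type v} {E : Type w}

/-! ### Operations -/

/-- `0`: one state, no transition, no final state. -/
def deadlock : PAut.{u} I E where
  State := PUnit
  trans := fun _ _ _ => False
  init := FinDist.dirac PUnit.unit
  final := ∅

/-- `1`: one state, which is final, and no transition. -/
def skip : PAut.{u} I E where
  State := PUnit
  trans := fun _ _ _ => False
  init := FinDist.dirac PUnit.unit
  final := Set.univ

/-- Transitions of `P + Q`; the new state `z` is `none`. -/
inductive AddTrans (P Q : PAut.{u} I E) :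
    Option (P.State ⊕ Q.State) → Act I E → FinDist (Option (P.State ⊕ Q.State)) → Prop
  | left {x : P.State} {a : Act I E} {μ : FinDist P.State} :
      P.trans x a μ → AddTrans P Q (some (Sum.inl x)) a (μ.map fun s => some (Sum.inl s))
  | right {y : Q.State} {a : Act I E} {ν : FinDist Q.State} :
      Q.trans y a ν → AddTrans P Q (some (Sum.inr y)) a (ν.map fun s => some (Sum.inr s))
  | startLeft : AddTrans P Q none Act.tau (P.init.map fun s => some (Sum.inl s))
  | startRight : AddTrans P Q none Act.tau (Q.init.map fun s => some (Sum.inr s))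

/-- Nondeterministic choice `P + Q`. -/
def add (P Q : PAut.{u} I E) : PAut.{u} I E where
  State := Option (P.State ⊕ Q.State)
  trans := AddTrans P Q
  init := FinDist.dirac none
  final := {s | (∃ x ∈ P.final, s = some (Sum.inl x)) ∨ (∃ y ∈ Q.final, s = some (Sum.inr y))}

/-- Transitions of `P · Q`. -/
inductive SeqTrans (P Q : PAut.{u} I E) :
    P.State ⊕ Q.State → Act I E → FinDist (P.State ⊕ Q.State) → Prop
  | left {x : P.State} {a : Act I E} {μ : FinDist P.State} :
      P.trans x a μ → SeqTrans P Q (Sum.inl x) a (μ.map Sum.inl)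
  | right {y : Q.State} {a : Act I E} {ν : FinDist Q.State} :
      Q.trans y a ν → SeqTrans P Q (Sum.inr y) a (ν.map Sum.inr)
  | pass {x : P.State} :
      x ∈ P.final → SeqTrans P Q (Sum.inl x) Act.tau (Q.init.map Sum.inr)

/-- Sequential composition `P · Q`. -/
def seq (P Q : PAut.{u} I E) : PAut.{u} I E where
  State := P.State ⊕ Q.State
  trans := SeqTrans P Q
  init := P.init.map Sum.inl
  final := Sum.inr '' Q.final

/-- Transitions of `P*`; the new state `z` is `none`. -/
inductive StarTrans (P : PAut.{u} I E) :
    Option P.State → Act I E → FinDist (Option P.State) → Prop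
  | inner {x : P.State} {a : Act I E} {μ : FinDist P.State} :
      P.trans x a μ → StarTrans P (some x) a (μ.map some)
  | start : StarTrans P none Act.tau (P.init.map some)
  | back {x : P.State} : x ∈ P.final → StarTrans P (some x) Act.tau (FinDist.dirac none)

/-- Kleene star `P*`. -/
def star (P : PAut.{u} I E) : PAut.{u} I E where
  State := Option P.State
  trans := StarTrans P
  init := FinDist.dirac none
  final := {none}

/-- Transitions of `P ⊕_p Q`. -/
inductive ChoiceTrans (P Q : PAut.{u} I E) :
    P.State ⊕ Q.State → Act I E → FinDist (P.State ⊕ Q.State) → Prop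
  | left {x : P.State} {a : Act I E} {μ : FinDist P.State} :
      P.trans x a μ → ChoiceTrans P Q (Sum.inl x) a (μ.map Sum.inl)
  | right {y : Q.State} {a : Act I E} {ν : FinDist Q.State} :
      Q.trans y a ν → ChoiceTrans P Q (Sum.inr y) a (ν.map Sum.inr)

/-- Probabilistic choice `P ⊕_p Q`: `P` with probability `p`, `Q` with probability `1 - p`. -/
def choice (p : unitInterval) (P Q : PAut.{u} I E) : PAut.{u} I E where
  State := P.State ⊕ Q.State
  trans := ChoiceTrans P Q
  init := FinDist.mix p (P.init.map Sum.inl) (Q.init.map Sum.inr)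
  final := Sum.inl '' P.final ∪ Sum.inr '' Q.final

/-- Transitions of the parallel composition that synchronises on the external actions in `A`. -/
inductive ParTrans (A : Set E) (P Q : PAut.{u} I E) :
    P.State × Q.State → Act I E → FinDist (P.State × Q.State) → Prop
  | sync {x : P.State} {y : Q.State} {a : Act I E} {μ : FinDist P.State} {ν : FinDist Q.State} :
      a ∈ Act.external '' A → P.trans x a μ → Q.trans y a ν →
        ParTrans A P Q (x, y) a (μ.prod ν)
  | left {x : P.State} {y : Q.State} {a : Act I E} {μ : FinDist P.State} :
      a ∉ Act.external '' A → P.trans x a μ →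
        ParTrans A P Q (x, y) a (μ.prod (FinDist.dirac y))
  | right {x : P.State} {y : Q.State} {a : Act I E} {ν : FinDist Q.State} :
      a ∉ Act.external '' A → Q.trans y a ν →
        ParTrans A P Q (x, y) a (FinDist.prod (FinDist.dirac x) ν)

/-- Parallel composition with frame `A`. -/
def parFrame (A : Set E) (P Q : PAut.{u} I E) : PAut.{u} I E where
  State := P.State × Q.State
  trans := ParTrans A P Q
  init := P.init.prod Q.init
  final := P.final ×ˢ Q.final

/-- Parallel composition `P ‖ Q` with synchronisation on all external actions. -/
def par (P Q : PAut.{u} I E) : PAut.{u} I E := parFrame Set.univ P Q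

/-! ### Weak transitions and simulation -/

/-- The transitions labelled by `a`, where those labelled by `τ` are extended with reflexivity. -/
def Step (P : PAut.{u} I E) (a : Act I E) (x : P.State) (μ : FinDist P.State) : Prop :=
  P.trans x a μ ∨ (a = Act.tau ∧ μ = FinDist.dirac x)

/-- `μ ⟹ μ'`: finitely many lifted `τ` steps. -/
def Weak (P : PAut.{u} I E) : FinDist P.State → FinDist P.State → Prop :=
  Relation.ReflTransGen (FinDist.Lift (P.Step Act.tau))

/-- `μ ⟹ᵃ μ'`. -/
def WeakStep (P : PAut.{u} I E) (a : Act I E) (μ μ' : FinDist P.State) : Prop :=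
  ∃ μ₁ μ₂, P.Weak μ μ₁ ∧ FinDist.Lift (P.Step a) μ₁ μ₂ ∧ P.Weak μ₂ μ'

/-- Probabilistic simulations from `P` to `Q`. -/
structure IsSimulation (P Q : PAut.{u} I E) (S : P.State → FinDist Q.State → Prop) : Prop where
  init : ∃ ν₀', FinDist.Lift S P.init ν₀' ∧ Q.Weak Q.init ν₀'
  step : ∀ x a μ' ν, P.trans x a μ' → S x ν → ∃ ν', Q.WeakStep a ν ν' ∧ FinDist.Lift S μ' ν'
  final : ∀ x ν, x ∈ P.final → S x ν →
    ∃ ν' : FinDist Q.State, (ν'.weights.support : Set Q.State) ⊆ Q.final ∧ Q.Weak ν ν'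

/-- `P ≤ Q`: there is a simulation from `P` to `Q`. -/
def SimLE (P Q : PAut.{u} I E) : Prop := ∃ S, IsSimulation P Q S

/-- `P ≡ Q`: simulation equivalence. -/
def SimEquiv (P Q : PAut.{u} I E) : Prop := SimLE P Q ∧ SimLE Q P

end PAut

/-! ### The algebras -/

/-- Weak concurrent Kleene algebras. The order `x ≤ y` is the natural one, `x + y = y`. -/
class WeakConcurrentKleeneAlgebra (K : Type u) extends Add K, Mul K, Zero K, One K where
  par : K → K → K
  star : K → K
  add_idem : ∀ x : K, x = x + x
  add_deadlock : ∀ x : K, x = x + 0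
  add_comm : ∀ x y : K, x + y = y + x
  add_assoc : ∀ x y z : K, x + (y + z) = (x + y) + z
  mul_skip : ∀ x : K, x = x * 1
  skip_mul : ∀ x : K, x = 1 * x
  deadlock_mul : ∀ x : K, 0 = 0 * x
  mul_assoc : ∀ x y z : K, x * (y * z) = (x * y) * z
  add_mul : ∀ x y z : K, x * z + y * z = (x + y) * z
  mul_add_sub : ∀ x y z : K, (x * y + x * z) + x * (y + z) = x * (y + z)
  star_unfold : ∀ x : K, star x = 1 + x * star x
  star_induction : ∀ x y : K, x * y + y = y → star x * y + y = y
  par_comm : ∀ x y : K, par x y = par y x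
  par_assoc : ∀ x y z : K, par x (par y z) = par (par x y) z
  exchange : ∀ x y x' y' : K,
    par x y * par x' y' + par (x * x') (y * y') = par (x * x') (y * y')
  par_add_sub : ∀ x y z : K, (par x y + par x z) + par x (y + z) = par x (y + z)

/-- Probabilistic concurrent Kleene algebras; `choice p x y` is `x ⊕_p y`. -/
class ProbConcurrentKleeneAlgebra (K : Type u) extends WeakConcurrentKleeneAlgebra K where
  choice : unitInterval → K → K → K
  choice_idem : ∀ (p : unitInterval) (x : K), x = choice p x x
  choice_comm : ∀ (p : unitInterval) (x y : K), choice p x y = choice (unitInterval.symm p) y x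
  choice_assoc : ∀ (p q p' q' : unitInterval) (x y z : K),
    (p' * q' : ℝ) = p → ((1 - p') * q' : ℝ) = (1 - p) * q → (1 - q' : ℝ) = (1 - p) * (1 - q) →
      choice p x (choice q y z) = choice q' (choice p' x y) z
  choice_mul : ∀ (p : unitInterval) (x y z : K), choice p x y * z = choice p (x * z) (y * z)
  mul_choice_sub : ∀ (p : unitInterval) (x y z : K),
    x * choice p y z + choice p (x * y) (x * z) = choice p (x * y) (x * z)
  par_choice : ∀ (p : unitInterval) (x y z : K),
    choice p (par x y) (par x z) = par x (choice p y z)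

end

noncomputable section

/-! ### The monad of finitely supported distributions. -/

namespace FinDist

open Convexity

variable {X : Type*} {Y : Type*} {Z : Type*} {W : Type*} {T : Type*}

/-! Every law reduces to one or two inequalities, each witnessed by an explicit simulation. What
makes this workable is convexity. A lifted relation can be presented by a kernel that sends a point
to a distribution over its related distributions (`Lift.exists_kernel`, which rests on
disintegration), so liftings are closed under averaging over any index type (`Lift.bind`). Weak
transitions are closed under averaging as well, because silent steps may idle (`convexRel_weak`).
Consequently a simulation answers moves of distributions and not only of states
(`IsSimRel.lift_weakStep`), simulations compose (`IsSimRel.comp`), and `SimLE` is a preorder.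

Sum is the least upper bound for this preorder (`le_add_left`, `le_add_right`, `add_le`). This
identifies the order with `P + Q ≡ Q`, gives the semilattice laws, and reduces the subdistributive
laws for `+` to monotonicity. Simulations out of a compound automaton are glued from relations on
its parts (`seq_le`, `star_le`, `choice_le`); many of the others are maps of states (`SimLE.of_map`)
or assign one distribution to each state (`SimLE.of_kernel`). Distributions as targets are essential
for laws such as `P ≤ P ⊕_p P` and `P · (Q ⊕_p R) ≤ P · Q ⊕_p P · R`, where one state is matched by
a mixture of two copies.

The least direct law is star induction (`star_seq_le`): the invariant at the loop state of `P*` is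
that the current distribution simulates the initial distribution of `Q`, and each round through `P`
restores it. -/

/-- Monadic composition of a distribution with a family of distributions. -/
def bind (μ : FinDist X) (f : X → FinDist Y) : FinDist Y := iConvexComb μ f

theorem iConvexComb_eq_bind (μ : FinDist X) (f : X → FinDist Y) :
    iConvexComb μ f = μ.bind f := rfl

@[simp] theorem single_bind (x : X) (f : X → FinDist Y) :
    bind (StdSimplex.single x : FinDist X) f = f x := by
  simp [bind, iConvexComb]

theorem weights_bind (μ : FinDist X) (f : X → FinDist Y) (y : Y) :
    (μ.bind f).weights y = ∑ x ∈ μ.weights.support, μ.weights x * (f x).weights y := by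
  simp only [bind, iConvexComb, StdSimplex.weights_sConvexComb, StdSimplex.weights_map]
  rw [Finsupp.sum_mapDomain_index (by simp) (by simp [add_smul])]
  simp [Finsupp.sum]

@[simp] theorem bind_single (μ : FinDist X) :
    μ.bind (fun x => (StdSimplex.single x : FinDist X)) = μ := by
  classical
  ext x
  simp +contextual [weights_bind, Finsupp.single_apply, eq_comm]

@[simp] theorem bind_bind (μ : FinDist X) (f : X → FinDist Y) (g : Y → FinDist Z) :
    (μ.bind f).bind g = μ.bind fun x => (f x).bind g :=
  (iConvexComb_assoc μ f g).symm

@[simp] theorem bind_const (μ : FinDist X) (ν : FinDist Y) : μ.bind (fun _ => ν) = ν :=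
  iConvexComb_const μ ν

theorem bind_congr {μ : FinDist X} {f g : X → FinDist Y}
    (h : ∀ x, μ.weights x ≠ 0 → f x = g x) : μ.bind f = μ.bind g :=
  iConvexComb_congr h

theorem bind_comm (μ : FinDist X) (ν : FinDist Y) (f : X → Y → FinDist Z) :
    (μ.bind fun x => ν.bind (f x)) = ν.bind fun y => μ.bind fun x => f x y :=
  iConvexComb_comm μ ν f

-- Together with `prod_eq_bind` this puts distributions in a normal form built from `bind` and point
-- masses, in which the monad laws settle most of the identities needed later.
@[simp] theorem map_eq_bind (μ : FinDist X) (f : X → Y) :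
    StdSimplex.map f μ = μ.bind fun x => (StdSimplex.single (f x) : FinDist Y) := by
  conv_lhs => rw [← bind_single μ]
  simp only [bind, map_iConvexComb]
  congr 1
  ext1 x
  simp

theorem weights_bind_ne_zero {μ : FinDist X} {f : X → FinDist Y} {y : Y} :
    (μ.bind f).weights y ≠ 0 ↔ ∃ x, μ.weights x ≠ 0 ∧ (f x).weights y ≠ 0 := by
  rw [weights_bind, ne_eq, Finset.sum_eq_zero_iff_of_nonneg
    (fun x _ => mul_nonneg (StdSimplex.weights_nonneg x) (StdSimplex.weights_nonneg y))]
  simp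

theorem weights_single_ne_zero {x y : X} :
    (StdSimplex.single x : FinDist X).weights y ≠ 0 ↔ y = x := by
  classical
  simp [Finsupp.single_apply, eq_comm]

theorem exists_weights_ne_zero (μ : FinDist X) : ∃ x, μ.weights x ≠ 0 := by
  obtain ⟨x, hx⟩ := μ.support_weights_nonempty
  exact ⟨x, by simpa using hx⟩

@[simp] theorem prod_eq_bind (μ : FinDist X) (ν : FinDist Y) :
    μ.prod ν = μ.bind fun x => ν.bind fun y => (StdSimplex.single (x, y) : FinDist (X × Y)) := by
  classical
  ext t
  obtain ⟨x, y⟩ := t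
  simp only [weights_bind, prod, Finsupp.onFinset_apply, StdSimplex.weights_single,
    Finsupp.single_apply, Prod.mk.injEq]
  have (x' : X) : ∑ y' ∈ ν.weights.support, ν.weights y' *
      (if x' = x ∧ y' = y then (1 : ℝ) else 0) = if x' = x then ν.weights y else 0 := by
    by_cases hx : x' = x
    · simp +contextual [hx, eq_comm]
    · simp [hx]
  rw [Finset.sum_congr rfl fun x' _ => by rw [this x']]
  by_cases hx : μ.weights x = 0 <;> simp [hx]

@[simp] theorem mix_bind (p : unitInterval) (μ ν : FinDist X) (f : X → FinDist Y) :
    (mix p μ ν).bind f = mix p (μ.bind f) (ν.bind f) := by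
  simp only [bind, mix, iConvexComb]
  rw [(StdSimplex.isAffineMap_map ℝ f).map_convexCombPair, sConvexComb_convexCombPair]

@[simp] theorem bind_mix (p : unitInterval) (μ : FinDist X) (f g : X → FinDist Y) :
    (μ.bind fun x => mix p (f x) (g x)) = mix p (μ.bind f) (μ.bind g) :=
  iConvexComb_convexCombPair_comm _ _ _ μ f g

@[simp] theorem mix_self (p : unitInterval) (μ : FinDist X) : mix p μ μ = μ :=
  convexCombPair_same _ _ _

theorem mix_symm (p : unitInterval) (μ ν : FinDist X) :
    mix (unitInterval.symm p) ν μ = mix p μ ν := by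
  ext x
  simp [mix, add_comm]

theorem mix_assoc {p q p' q' : unitInterval} (h₁ : (p' * q' : ℝ) = p)
    (h₂ : ((1 - p') * q' : ℝ) = (1 - p) * q) (h₃ : (1 - q' : ℝ) = (1 - p) * (1 - q))
    (μ ν ξ : FinDist X) : mix p μ (mix q ν ξ) = mix q' (mix p' μ ν) ξ := by
  ext x
  simp only [mix, StdSimplex.weights_convexCombPair, Finsupp.add_apply, Finsupp.smul_apply,
    smul_eq_mul]
  linear_combination (-μ.weights x) * h₁ - ν.weights x * h₂ - ξ.weights x * h₃

/-- The mixture as the image of a distribution on two points. -/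
theorem mix_eq_bind (p : unitInterval) (μ ν : FinDist X) :
    mix p μ ν = (mix p (dirac true) (dirac false)).bind fun b => cond b μ ν := by
  simp

/-- Disintegration of a distribution along a map. -/
theorem exists_disintegration (θ : FinDist T) (g : T → X) :
    ∃ κ : X → FinDist T, θ.bind (fun t => κ (g t)) = θ ∧
      ∀ t s, θ.weights t ≠ 0 → (κ (g t)).weights s ≠ 0 → g s = g t ∧ θ.weights s ≠ 0 := by
  classical
  -- The kernel is `θ` conditioned on the fibre of `g`. Over fibres of mass zero the value `θ` is
  -- arbitrary and never enters the average.
  refine ⟨fun x => if h : ∃ t ∈ g ⁻¹' {x}, θ.weights t ≠ 0 then θ.restrict _ h else θ, ?_, ?_⟩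
  · ext t
    rw [weights_bind]
    have key : ∀ t' ∈ θ.weights.support, θ.weights t' *
        (if h : ∃ s ∈ g ⁻¹' {g t'}, θ.weights s ≠ 0 then θ.restrict _ h else θ).weights t =
        (if g t' = g t then θ.weights t' else 0) *
          ((∑ s ∈ θ.weights.support, if g s = g t then θ.weights s else 0)⁻¹ * θ.weights t) := by
      intro t' ht'
      rw [dif_pos ⟨t', rfl, by simpa using ht'⟩, StdSimplex.weights_restrict]
      simp only [Finsupp.smul_apply, smul_eq_mul, Finsupp.filter_apply, Set.mem_preimage,
        Set.mem_singleton_iff]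
      by_cases h : g t' = g t
      · rw [if_pos h.symm, if_pos h, h]
        congr 3
        rw [Finsupp.sum, Finsupp.support_filter, Finset.sum_filter]
        simp +contextual
      · rw [if_neg (Ne.symm h), if_neg h]
        simp
    rw [Finset.sum_congr rfl key, ← Finset.sum_mul, ← mul_assoc]
    by_cases ht : θ.weights t = 0
    · simp [ht]
    -- The sum over the fibre cancels the normalising constant, which is nonzero because `t` lies in
    -- the fibre.
    rw [mul_inv_cancel₀, one_mul]
    apply ne_of_gt
    apply Finset.sum_pos'
    · intro i _
      split_ifs
      exacts [StdSimplex.weights_nonneg i, le_rfl]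
    · exact ⟨t, by simpa using ht, by
        rw [if_pos rfl]; exact lt_of_le_of_ne (StdSimplex.weights_nonneg t) (Ne.symm ht)⟩
  · intro t s ht hs
    dsimp only at hs
    rw [dif_pos (⟨t, rfl, ht⟩ : ∃ s ∈ g ⁻¹' {g t}, θ.weights s ≠ 0), ← Finsupp.mem_support_iff, StdSimplex.support_weights_restrict] at hs
    simpa [and_comm] using hs

/-- Every finitely supported distribution is the image of a distribution on some `Fin n` under a
map into its support. -/
theorem exists_fin_bind (θ : FinDist T) :
    ∃ (n : ℕ) (q : FinDist (Fin n)) (g : Fin n → T), (∀ i, θ.weights (g i) ≠ 0) ∧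
      q.bind (fun i => (StdSimplex.single (g i) : FinDist T)) = θ := by
  classical
  let e := θ.weights.support.equivFin
  have hsum (F : T → ℝ) : ∑ i : Fin θ.weights.support.card, F (e.symm i) = ∑ t ∈ θ.weights.support, F t :=
    (Equiv.sum_comp e.symm fun t : θ.weights.support => F t).trans (Finset.sum_coe_sort _ F)
  refine ⟨_, ⟨Finsupp.equivFunOnFinite.symm fun i => θ.weights (e.symm i), ?_, ?_⟩,
    fun i => e.symm i, fun i => Finsupp.mem_support_iff.1 (e.symm i).2, ?_⟩
  · intro i
    exact StdSimplex.weights_nonneg (w := θ) _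
  · rw [Finsupp.sum_fintype _ _ (fun _ => rfl)]
    exact (hsum _).trans θ.total
  · ext t
    rw [weights_bind, Finset.sum_subset (Finset.subset_univ _)]
    · simp only [Finsupp.equivFunOnFinite_symm_apply_apply, StdSimplex.weights_single]
      rw [hsum fun s => θ.weights s * (Finsupp.single s (1 : ℝ)) t]
      simp +contextual [Finsupp.single_apply, eq_comm]
    · intro i _ hi
      simp only [Finsupp.mem_support_iff, not_not] at hi
      simp [hi]

/-! ### Liftings of relations and convex relations. -/

/-- Frees liftings from the index type `Fin n` of the definition: enumerating the support of `θ`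
suffices, so the hypothesis is needed only there. -/
theorem Lift.of_bind_single {S : X → FinDist Y → Prop} (θ : FinDist T) {x : T → X}
    {ν : T → FinDist Y} (h : ∀ t, θ.weights t ≠ 0 → S (x t) (ν t)) :
    Lift S (θ.bind fun t => (StdSimplex.single (x t) : FinDist X)) (θ.bind ν) := by
  obtain ⟨n, q, g, hg, rfl⟩ := exists_fin_bind θ
  exact ⟨n, q, fun i => x (g i), fun i => ν (g i), by simp [iConvexComb_eq_bind],
    fun i => h _ (hg i), by simp [iConvexComb_eq_bind]⟩

theorem Lift.of_rel {S : X → FinDist Y → Prop} {x : X} {ν : FinDist Y} (h : S x ν) :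
    Lift S (StdSimplex.single x) ν := by
  simpa using Lift.of_bind_single (StdSimplex.single () : FinDist Unit)
    (x := fun _ => x) (ν := fun _ => ν) (fun _ _ => h)

/-- A lifting is given by a family of distributions over the related distributions. -/
theorem Lift.exists_kernel {S : X → FinDist Y → Prop} {μ : FinDist X} {ν : FinDist Y}
    (h : Lift S μ ν) : ∃ κ : X → FinDist (FinDist Y),
      (∀ x, μ.weights x ≠ 0 → ∀ ξ, (κ x).weights ξ ≠ 0 → S x ξ) ∧
      ν = μ.bind fun x => (κ x).bind id := by
  obtain ⟨n, p, x, ν', rfl, hS, rfl⟩ := h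
  -- Several indices may carry the same point `x i`. Given a point, the index is drawn from the
  -- conditional law and then mapped through `ν'`.
  obtain ⟨κ, hκ, hκ'⟩ := exists_disintegration p x
  refine ⟨fun y => (κ y).bind fun i => StdSimplex.single (ν' i), ?_, ?_⟩
  · intro y hy ξ hξ
    obtain ⟨i, hi, hyi⟩ := weights_bind_ne_zero.1 hy
    obtain rfl := weights_single_ne_zero.1 hyi
    obtain ⟨j, hj, hξj⟩ := weights_bind_ne_zero.1 hξ
    obtain rfl := weights_single_ne_zero.1 hξj
    rw [← (hκ' i j hi hj).1]
    exact hS j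
  · simp only [iConvexComb_eq_bind, bind_bind, single_bind, id]
    conv_lhs => rw [← hκ]
    simp

theorem Lift.of_kernel {S : X → FinDist Y → Prop} {μ : FinDist X} (κ : X → FinDist (FinDist Y))
    (h : ∀ x, μ.weights x ≠ 0 → ∀ ξ, (κ x).weights ξ ≠ 0 → S x ξ) :
    Lift S μ (μ.bind fun x => (κ x).bind id) := by
  have := Lift.of_bind_single (S := S)
    (μ.bind fun x => (κ x).bind fun ξ => (StdSimplex.single (x, ξ) : FinDist (X × FinDist Y)))
    (x := Prod.fst) (ν := Prod.snd) ?_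
  · simpa [Function.id_def] using this
  · rintro ⟨x, ξ⟩ ht
    obtain ⟨x', hx, ht⟩ := weights_bind_ne_zero.1 ht
    obtain ⟨ξ', hξ, ht⟩ := weights_bind_ne_zero.1 ht
    obtain ⟨rfl, rfl⟩ := Prod.mk.inj (weights_single_ne_zero.1 ht)
    exact h _ hx _ hξ

/-- Drawing `t`, then `x`, then `ξ` from the kernel belonging to `t` gives a joint law of related
pairs `(x, ξ)`; its two marginal averages are the two sides. -/
theorem Lift.bind {S : X → FinDist Y → Prop} {μ : FinDist T} {f : T → FinDist X}
    {g : T → FinDist Y} (h : ∀ t, μ.weights t ≠ 0 → Lift S (f t) (g t)) :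
    Lift S (μ.bind f) (μ.bind g) := by
  have : Nonempty (X → FinDist (FinDist Y)) :=
    let ⟨t, ht⟩ := exists_weights_ne_zero μ
    ⟨(h t ht).exists_kernel.choose⟩
  choose! κ hκ hg using fun t ht => (h t ht).exists_kernel
  have := Lift.of_bind_single (S := S)
    (μ.bind fun t => (f t).bind fun x => (κ t x).bind fun ξ =>
      (StdSimplex.single (x, ξ) : FinDist (X × FinDist Y)))
    (x := Prod.fst) (ν := Prod.snd) ?_
  · rw [bind_congr hg]
    simpa [Function.id_def] using this
  · rintro ⟨x, ξ⟩ ht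
    obtain ⟨t, htμ, ht⟩ := weights_bind_ne_zero.1 ht
    obtain ⟨x', hx, ht⟩ := weights_bind_ne_zero.1 ht
    obtain ⟨ξ', hξ, ht⟩ := weights_bind_ne_zero.1 ht
    obtain ⟨rfl, rfl⟩ := Prod.mk.inj (weights_single_ne_zero.1 ht)
    exact hκ t htμ _ hx _ hξ

theorem Lift.of_forall {S : X → FinDist Y → Prop} (μ : FinDist X) {f : X → FinDist Y}
    (h : ∀ x, μ.weights x ≠ 0 → Lift S (StdSimplex.single x) (f x)) :
    Lift S μ (μ.bind f) := by
  simpa using Lift.bind (f := fun x => (StdSimplex.single x : FinDist X)) h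

/-- A relation between distributions is convex if it is closed under convex combinations. -/
def ConvexRel (R : FinDist X → FinDist Y → Prop) : Prop :=
  ∀ (n : ℕ) (p : FinDist (Fin n)) (f : Fin n → FinDist X) (g : Fin n → FinDist Y),
    (∀ i, R (f i) (g i)) → R (p.bind f) (p.bind g)

theorem ConvexRel.bind {R : FinDist X → FinDist Y → Prop} (hR : ConvexRel R) {μ : FinDist T}
    {f : T → FinDist X} {g : T → FinDist Y} (h : ∀ t, μ.weights t ≠ 0 → R (f t) (g t)) :
    R (μ.bind f) (μ.bind g) := by
  obtain ⟨n, q, e, he, rfl⟩ := exists_fin_bind μ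
  simpa using hR n q _ _ fun i => h _ (he i)

theorem ConvexRel.mix {R : FinDist X → FinDist Y → Prop} (hR : ConvexRel R) (p : unitInterval)
    {μ μ' : FinDist X} {ν ν' : FinDist Y} (h : R μ ν) (h' : R μ' ν') :
    R (mix p μ μ') (mix p ν ν') := by
  rw [mix_eq_bind p μ, mix_eq_bind p ν]
  exact hR.bind fun b _ => by cases b <;> assumption

theorem convexRel_lift (S : X → FinDist Y → Prop) : ConvexRel (Lift S) :=
  fun _ _ _ _ h => Lift.bind fun i _ => h i

/-- Transport of a lifting along affine maps into a convex relation. -/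
theorem Lift.transport {S : X → FinDist Y → Prop} {R : FinDist Z → FinDist W → Prop}
    (hR : ConvexRel R) {g : X → FinDist Z} {k : Y → FinDist W} {μ : FinDist X} {ν : FinDist Y}
    (h : Lift S μ ν) (hS : ∀ x ξ, S x ξ → R (g x) (ξ.bind k)) :
    R (μ.bind g) (ν.bind k) := by
  obtain ⟨n, p, x, ν', rfl, hS', rfl⟩ := h
  simpa [iConvexComb_eq_bind] using hR n p _ _ fun i => hS _ _ (hS' i)

theorem Lift.map {S : X → FinDist Y → Prop} {T : Z → FinDist W → Prop} {g : X → Z}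
    {k : Y → FinDist W} {μ : FinDist X} {ν : FinDist Y} (h : Lift S μ ν)
    (hS : ∀ x ξ, S x ξ → T (g x) (ξ.bind k)) :
    Lift T (μ.bind fun x => StdSimplex.single (g x)) (ν.bind k) :=
  h.transport (convexRel_lift T) fun x ξ hx => .of_rel (hS x ξ hx)

theorem Lift.map_left {S : X → FinDist Y → Prop} {T : Z → FinDist Y → Prop} {g : X → Z}
    {μ : FinDist X} {ν : FinDist Y} (h : Lift S μ ν) (hS : ∀ x ξ, S x ξ → T (g x) ξ) :
    Lift T (μ.bind fun x => StdSimplex.single (g x)) ν := by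
  simpa using h.map (T := T) (k := fun y => StdSimplex.single y) (by simpa using hS)

theorem Lift.mono {S T : X → FinDist Y → Prop} {μ : FinDist X} {ν : FinDist Y}
    (h : Lift S μ ν) (hS : ∀ x ξ, S x ξ → T x ξ) : Lift T μ ν := by
  obtain ⟨n, p, x, ν', rfl, hS', rfl⟩ := h
  exact ⟨n, p, x, ν', rfl, fun i => hS _ _ (hS' i), rfl⟩

end FinDist

/-! ### Weak transitions. -/

namespace PAut

open FinDist Convexity

variable {I : Type v} {E : Type w} {P P' Q Q' R : PAut.{u} I E} {a : Act I E}

theorem lift_step_tau_refl (P : PAut.{u} I E) (μ : FinDist P.State) :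
    Lift (P.Step Act.tau) μ μ := by
  simpa using Lift.of_forall (S := P.Step Act.tau) μ
    (f := fun x => StdSimplex.single x) fun x _ => Lift.of_rel (Or.inr ⟨rfl, rfl⟩)

theorem Weak.refl (μ : FinDist P.State) : P.Weak μ μ := Relation.ReflTransGen.refl

theorem Weak.trans {μ ν ξ : FinDist P.State} (h : P.Weak μ ν) (h' : P.Weak ν ξ) : P.Weak μ ξ :=
  Relation.ReflTransGen.trans h h'

theorem Weak.of_lift {μ ν : FinDist P.State} (h : Lift (P.Step Act.tau) μ ν) : P.Weak μ ν :=
  Relation.ReflTransGen.single h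

theorem Weak.of_trans {x : P.State} {ν : FinDist P.State} (h : P.trans x Act.tau ν) :
    P.Weak (StdSimplex.single x) ν :=
  .of_lift (.of_rel (Or.inl h))

/-- The given weak transitions may have different lengths, so they are run one index at a time while
all other components idle by reflexive silent steps. -/
theorem convexRel_weak (P : PAut.{u} I E) : ConvexRel P.Weak := by
  classical
  intro n p f g h
  -- The set `s` records the indices that have already completed their transition.
  have key (s : Finset (Fin n)) : P.Weak (p.bind f) (p.bind fun i => if i ∈ s then g i else f i) := by
    induction s using Finset.induction_on with
    | empty => simpa using Weak.refl _
    | insert j s hj ih =>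
      refine ih.trans ?_
      have h₁ : (fun i => if i ∈ s then g i else f i) =
          Function.update (fun i => if i ∈ s then g i else f i) j (f j) := by
        simp [hj]
      have h₂ : (fun i => if i ∈ insert j s then g i else f i) =
          Function.update (fun i => if i ∈ s then g i else f i) j (g j) := by
        ext1 i
        by_cases hi : i = j
        · subst hi; simp
        · simp [hi]
      rw [h₁, h₂]
      refine Relation.ReflTransGen.lift
        (fun ν => p.bind (Function.update (fun i => if i ∈ s then g i else f i) j ν))
        (fun ν ν' hν => ?_) _ _ (h j)
      refine Lift.bind fun i _ => ?_
      by_cases hi : i = j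
      · subst hi; simpa using hν
      · simpa [hi] using P.lift_step_tau_refl _
  simpa using key Finset.univ

theorem convexRel_weakStep (P : PAut.{u} I E) (a : Act I E) : ConvexRel (P.WeakStep a) := by
  intro n p f g h
  choose μ₁ μ₂ h₁ h₂ h₃ using h
  exact ⟨p.bind μ₁, p.bind μ₂, P.convexRel_weak n p _ _ h₁, convexRel_lift _ n p _ _ h₂,
    P.convexRel_weak n p _ _ h₃⟩

theorem WeakStep.weak {μ ν : FinDist P.State} (h : P.WeakStep Act.tau μ ν) : P.Weak μ ν := by
  obtain ⟨μ₁, μ₂, h₁, h₂, h₃⟩ := h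
  exact h₁.trans ((Weak.of_lift h₂).trans h₃)

theorem Weak.weakStep {μ ν : FinDist P.State} (h : P.Weak μ ν) : P.WeakStep Act.tau μ ν :=
  ⟨ν, ν, h, P.lift_step_tau_refl ν, .refl ν⟩

theorem WeakStep.of_lift {μ ν : FinDist P.State} (h : Lift (P.Step a) μ ν) : P.WeakStep a μ ν :=
  ⟨μ, ν, .refl μ, h, .refl ν⟩

theorem WeakStep.of_trans {x : P.State} {ν : FinDist P.State} (h : P.trans x a ν) :
    P.WeakStep a (StdSimplex.single x) ν :=
  .of_lift (.of_rel (Or.inl h))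

theorem WeakStep.trans_weak {μ ν ξ : FinDist P.State} (h : P.WeakStep a μ ν) (h' : P.Weak ν ξ) :
    P.WeakStep a μ ξ := by
  obtain ⟨μ₁, μ₂, h₁, h₂, h₃⟩ := h
  exact ⟨μ₁, μ₂, h₁, h₂, h₃.trans h'⟩

theorem Weak.trans_weakStep {μ ν ξ : FinDist P.State} (h : P.Weak μ ν) (h' : P.WeakStep a ν ξ) :
    P.WeakStep a μ ξ := by
  obtain ⟨μ₁, μ₂, h₁, h₂, h₃⟩ := h'
  exact ⟨μ₁, μ₂, h.trans h₁, h₂, h₃⟩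

/-- Weak transitions are transported by a family of distributions that respects steps. -/
theorem Weak.transport {h : P.State → FinDist Q.State}
    (hh : ∀ x μ, P.trans x Act.tau μ → Q.Weak (h x) (μ.bind h)) {μ ν : FinDist P.State}
    (hμ : P.Weak μ ν) : Q.Weak (μ.bind h) (ν.bind h) := by
  induction hμ with
  | refl => exact .refl _
  | tail _ hs ih =>
    refine ih.trans (hs.transport Q.convexRel_weak ?_)
    rintro x ξ (hx | ⟨-, rfl⟩)
    · exact hh x ξ hx
    · simpa using Weak.refl _

theorem WeakStep.transport {h : P.State → FinDist Q.State}
    (hτ : ∀ x μ, P.trans x Act.tau μ → Q.Weak (h x) (μ.bind h))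
    (ha : ∀ x μ, P.trans x a μ → Q.WeakStep a (h x) (μ.bind h)) {μ ν : FinDist P.State}
    (hμ : P.WeakStep a μ ν) : Q.WeakStep a (μ.bind h) (ν.bind h) := by
  obtain ⟨μ₁, μ₂, h₁, h₂, h₃⟩ := hμ
  refine ((h₁.transport hτ).trans_weakStep (h₂.transport (Q.convexRel_weakStep a) ?_)).trans_weak
    (h₃.transport hτ)
  rintro x ξ (hx | ⟨rfl, rfl⟩)
  · exact ha x ξ hx
  · simpa using (Weak.refl (h x)).weakStep

/-- Weak transitions are transported by a map that preserves transitions. -/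
theorem Weak.map {f : P.State → Q.State}
    (hf : ∀ b x μ, P.trans x b μ → Q.trans (f x) b (μ.bind fun y => StdSimplex.single (f y))) {μ ν : FinDist P.State}
    (hμ : P.Weak μ ν) : Q.Weak (μ.bind fun x => StdSimplex.single (f x))
      (ν.bind fun x => StdSimplex.single (f x)) :=
  hμ.transport fun x μ hx => .of_trans (hf _ x μ hx)

theorem WeakStep.map {f : P.State → Q.State}
    (hf : ∀ b x μ, P.trans x b μ → Q.trans (f x) b (μ.bind fun y => StdSimplex.single (f y))) {μ ν : FinDist P.State}
    (hμ : P.WeakStep a μ ν) : Q.WeakStep a (μ.bind fun x => StdSimplex.single (f x))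
      (ν.bind fun x => StdSimplex.single (f x)) :=
  hμ.transport (fun x μ hx => .of_trans (hf _ x μ hx))
    fun x μ hx => .of_trans (hf _ x μ hx)

/-! ### Weak termination. -/

/-- `μ` can weakly reach a distribution on final states. -/
def CanTerminate (P : PAut.{u} I E) (μ : FinDist P.State) : Prop :=
  ∃ ν : FinDist P.State, (ν.weights.support : Set P.State) ⊆ P.final ∧ P.Weak μ ν

theorem CanTerminate.of_mem {x : P.State} (hx : x ∈ P.final) :
    P.CanTerminate (StdSimplex.single x) :=
  ⟨StdSimplex.single x, fun y hy => by
    obtain rfl := weights_single_ne_zero.1 (Finsupp.mem_support_iff.1 hy)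
    exact hx, .refl _⟩

theorem CanTerminate.of_weak {μ ν : FinDist P.State} (h : P.Weak μ ν) (hν : P.CanTerminate ν) :
    P.CanTerminate μ :=
  let ⟨ξ, hξ, h'⟩ := hν
  ⟨ξ, hξ, h.trans h'⟩

theorem CanTerminate.bind {T : Type*} {μ : FinDist T} {f : T → FinDist P.State}
    (h : ∀ t, μ.weights t ≠ 0 → P.CanTerminate (f t)) : P.CanTerminate (μ.bind f) := by
  have : Nonempty (FinDist P.State) :=
    let ⟨t, ht⟩ := exists_weights_ne_zero μ
    ⟨(h t ht).choose⟩
  choose! g hg hg' using h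
  refine ⟨μ.bind g, fun y hy => ?_, P.convexRel_weak.bind hg'⟩
  obtain ⟨t, ht, hy⟩ := weights_bind_ne_zero.1 (Finsupp.mem_support_iff.1 hy)
  exact hg t ht (Finsupp.mem_support_iff.2 hy)

theorem CanTerminate.map {f : P.State → Q.State}
    (hf : ∀ b x μ, P.trans x b μ → Q.trans (f x) b (μ.bind fun y => StdSimplex.single (f y)))
    (hF : ∀ x ∈ P.final, f x ∈ Q.final) {μ : FinDist P.State} (hμ : P.CanTerminate μ) :
    Q.CanTerminate (μ.bind fun x => StdSimplex.single (f x)) := by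
  obtain ⟨ν, hν, hw⟩ := hμ
  exact .of_weak (hw.map hf) <| .bind fun x hx =>
    .of_mem (hF x (hν (Finsupp.mem_support_iff.2 hx)))

/-- A distribution that can terminate weakly reaches everything that all final states reach. -/
theorem CanTerminate.weak_const {f : P.State → Q.State}
    (hf : ∀ b x μ, P.trans x b μ → Q.trans (f x) b (μ.bind fun y => StdSimplex.single (f y))) {ξ : FinDist Q.State}
    (hF : ∀ x ∈ P.final, Q.Weak (StdSimplex.single (f x)) ξ) {μ : FinDist P.State}
    (hμ : P.CanTerminate μ) : Q.Weak (μ.bind fun x => StdSimplex.single (f x)) ξ := by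
  obtain ⟨ν, hν, hw⟩ := hμ
  refine (hw.map hf).trans ?_
  rw [← bind_const ν ξ]
  exact Q.convexRel_weak.bind fun x hx => hF x (hν (Finsupp.mem_support_iff.2 hx))

theorem CanTerminate.mix (p : unitInterval) {μ ν : FinDist P.State}
    (hμ : P.CanTerminate μ) (hν : P.CanTerminate ν) : P.CanTerminate (mix p μ ν) := by
  rw [mix_eq_bind]
  exact .bind fun b _ => by cases b <;> assumption

/-! ### Simulation relations, their action on distributions, and composition. -/

/-- The condition on transitions of a simulation. -/
def IsStepSim (P Q : PAut.{u} I E) (S : P.State → FinDist Q.State → Prop) : Prop :=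
  ∀ x a μ' ν, P.trans x a μ' → S x ν → ∃ ν', Q.WeakStep a ν ν' ∧ Lift S μ' ν'

/-- The conditions on transitions and on final states of a simulation. -/
structure IsSimRel (P Q : PAut.{u} I E) (S : P.State → FinDist Q.State → Prop) : Prop where
  step : IsStepSim P Q S
  final : ∀ x ν, x ∈ P.final → S x ν → Q.CanTerminate ν

theorem IsSimulation.isSimRel {S : P.State → FinDist Q.State → Prop} (h : IsSimulation P Q S) :
    IsSimRel P Q S :=
  ⟨h.step, h.final⟩

theorem IsSimRel.simLE {S : P.State → FinDist Q.State → Prop} (h : IsSimRel P Q S)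
    {ν : FinDist Q.State} (hν : Lift S P.init ν) (hQ : Q.Weak Q.init ν) : SimLE P Q :=
  ⟨S, ⟨ν, hν, hQ⟩, h.step, h.final⟩

theorem SimLE.exists_simRel (h : SimLE P Q) : ∃ S ν, IsSimRel P Q S ∧ Lift S P.init ν ∧
    Q.Weak Q.init ν :=
  let ⟨S, hS⟩ := h
  let ⟨ν, hν, hQ⟩ := hS.init
  ⟨S, ν, hS.isSimRel, hν, hQ⟩

namespace IsSimRel

variable {S : P.State → FinDist Q.State → Prop}

/-- The presentations of `ν` and `μ'` may split the same state `x` differently. Drawing the related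
`ξ` and the successor `ζ` independently given `x` refines both, and each triple `(x, ξ, ζ)` is
answered separately. -/
theorem lift_step (hS : IsSimRel P Q S) {μ μ' : FinDist P.State} {ν : FinDist Q.State}
    (h : Lift S μ ν) (hμ : Lift (P.Step a) μ μ') :
    ∃ ν', Q.WeakStep a ν ν' ∧ Lift S μ' ν' := by
  obtain ⟨κ, hκ, rfl⟩ := h.exists_kernel
  obtain ⟨l, hl, rfl⟩ := hμ.exists_kernel
  have (x : P.State) (ξ : FinDist Q.State) (ζ : FinDist P.State) : ∃ ν', S x ξ → P.Step a x ζ →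
      Q.WeakStep a ξ ν' ∧ Lift S ζ ν' := by
    by_cases hx : S x ξ ∧ P.Step a x ζ
    · obtain ⟨hxξ, hζ | ⟨rfl, rfl⟩⟩ := hx
      · obtain ⟨ν', h'⟩ := hS.step x a ζ ξ hζ hxξ
        exact ⟨ν', fun _ _ => h'⟩
      · exact ⟨ξ, fun _ _ => ⟨(Weak.refl ξ).weakStep, .of_rel hxξ⟩⟩
    · exact ⟨ξ, fun h₁ h₂ => (hx ⟨h₁, h₂⟩).elim⟩
  choose F hF using this
  refine ⟨μ.bind fun x => (κ x).bind fun ξ => (l x).bind fun ζ => F x ξ ζ, ?_, ?_⟩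
  · have hR := Q.convexRel_weakStep a
    refine hR.bind fun x hx => hR.bind fun ξ hξ => ?_
    -- Viewing `ξ` as a constant family over the successors lets different successors receive
    -- different answers.
    rw [← bind_const (l x) (id ξ)]
    exact hR.bind fun ζ hζ => (hF x ξ ζ (hκ x hx ξ hξ) (hl x hx ζ hζ)).1
  · refine Lift.bind fun x hx => ?_
    rw [← bind_const (κ x) ((l x).bind id)]
    exact Lift.bind fun ξ hξ => Lift.bind fun ζ hζ =>
      (hF x ξ ζ (hκ x hx ξ hξ) (hl x hx ζ hζ)).2

theorem lift_weak (hS : IsSimRel P Q S) {μ μ' : FinDist P.State} {ν : FinDist Q.State}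
    (h : Lift S μ ν) (hμ : P.Weak μ μ') : ∃ ν', Q.Weak ν ν' ∧ Lift S μ' ν' := by
  induction hμ with
  | refl => exact ⟨ν, .refl ν, h⟩
  | tail _ hs ih =>
    obtain ⟨ν₁, hν₁, h₁⟩ := ih
    obtain ⟨ν₂, hν₂, h₂⟩ := hS.lift_step h₁ hs
    exact ⟨ν₂, hν₁.trans hν₂.weak, h₂⟩

theorem lift_weakStep (hS : IsSimRel P Q S) {μ μ' : FinDist P.State} {ν : FinDist Q.State}
    (h : Lift S μ ν) (hμ : P.WeakStep a μ μ') : ∃ ν', Q.WeakStep a ν ν' ∧ Lift S μ' ν' := by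
  obtain ⟨μ₁, μ₂, hμ₁, hμ₂, hμ₃⟩ := hμ
  obtain ⟨ν₁, hν₁, h₁⟩ := hS.lift_weak h hμ₁
  obtain ⟨ν₂, hν₂, h₂⟩ := hS.lift_step h₁ hμ₂
  obtain ⟨ν₃, hν₃, h₃⟩ := hS.lift_weak h₂ hμ₃
  exact ⟨ν₃, (hν₁.trans_weakStep hν₂).trans_weak hν₃, h₃⟩

theorem lift_canTerminate (hS : IsSimRel P Q S) {μ : FinDist P.State} {ν : FinDist Q.State}
    (h : Lift S μ ν) (hμ : P.CanTerminate μ) : Q.CanTerminate ν := by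
  obtain ⟨μ', hμ', hw⟩ := hμ
  obtain ⟨ν', hν', h'⟩ := hS.lift_weak h hw
  obtain ⟨κ, hκ, rfl⟩ := h'.exists_kernel
  exact .of_weak hν' <| .bind fun x hx => .bind fun ξ hξ =>
    hS.final x ξ (hμ' (Finsupp.mem_support_iff.2 hx)) (hκ x hx ξ hξ)

end IsSimRel

/-- The first kernel splits `ν` into pieces `η` attached to points `x`, and the second kernel
carries each piece on. The second relation appears lifted because `S` ends in distributions. -/
theorem lift_comp {X Y Z : Type*} {S : X → FinDist Y → Prop} {T : Y → FinDist Z → Prop}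
    {μ : FinDist X} {ν : FinDist Y} {ξ : FinDist Z} (h : Lift S μ ν) (h' : Lift T ν ξ) :
    Lift (fun x ζ => ∃ η, S x η ∧ Lift T η ζ) μ ξ := by
  obtain ⟨κ, hκ, rfl⟩ := h.exists_kernel
  obtain ⟨l, hl, rfl⟩ := h'.exists_kernel
  simp only [bind_bind, id]
  refine Lift.of_forall _ fun x hx => ?_
  rw [← bind_const (κ x) (StdSimplex.single x)]
  refine Lift.bind fun η hη => Lift.of_rel ⟨η, hκ x hx η hη, ?_⟩
  exact Lift.of_kernel l fun y hy => hl y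
    (weights_bind_ne_zero.2 ⟨x, hx, weights_bind_ne_zero.2 ⟨η, hη, hy⟩⟩)

theorem IsSimRel.comp {S : P.State → FinDist Q.State → Prop} {T : Q.State → FinDist R.State → Prop}
    (hS : IsSimRel P Q S) (hT : IsSimRel Q R T) :
    IsSimRel P R fun x ξ => ∃ ν, S x ν ∧ Lift T ν ξ where
  step := by
    rintro x a μ' ξ hx ⟨ν, hν, hξ⟩
    obtain ⟨ν', hν', h'⟩ := hS.step x a μ' ν hx hν
    obtain ⟨ξ', hξ', h''⟩ := hT.lift_weakStep hξ hν'
    exact ⟨ξ', hξ', lift_comp h' h''⟩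
  final := by
    rintro x ξ hx ⟨ν, hν, hξ⟩
    exact hT.lift_canTerminate hξ (hS.final x ν hx hν)

theorem SimLE.trans (h : SimLE P Q) (h' : SimLE Q R) : SimLE P R := by
  obtain ⟨S, ν, hS, hν, hw⟩ := h.exists_simRel
  obtain ⟨T, ξ, hT, hξ, hw'⟩ := h'.exists_simRel
  obtain ⟨ξ', hξ', h''⟩ := hT.lift_weak hξ hw
  exact (hS.comp hT).simLE (lift_comp hν h'') (hw'.trans hξ')

/-- A simulation that relates every state with a single distribution. -/
theorem SimLE.of_kernel (h : P.State → FinDist Q.State) (init : Q.Weak Q.init (P.init.bind h))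
    (step : ∀ x a μ, P.trans x a μ → Q.WeakStep a (h x) (μ.bind h))
    (final : ∀ x ∈ P.final, Q.CanTerminate (h x)) : SimLE P Q := by
  have hl (μ : FinDist P.State) : Lift (fun x ν => ν = h x) μ (μ.bind h) :=
    Lift.of_forall μ fun x _ => .of_rel rfl
  refine IsSimRel.simLE (S := fun x ν => ν = h x) ⟨?_, ?_⟩ (hl _) init
  · rintro x a μ _ hx rfl
    exact ⟨_, step x a μ hx, hl μ⟩
  · rintro x _ hx rfl
    exact final x hx

theorem SimLE.of_map (f : P.State → Q.State)
    (init : Q.init = P.init.bind fun x => StdSimplex.single (f x))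
    (step : ∀ x a μ, P.trans x a μ → Q.trans (f x) a (μ.bind fun x => StdSimplex.single (f x)))
    (final : ∀ x ∈ P.final, f x ∈ Q.final) : SimLE P Q :=
  .of_kernel (fun x => StdSimplex.single (f x)) (init ▸ .refl _)
    (fun x a μ hx => .of_trans (step x a μ hx)) fun x hx => .of_mem (final x hx)

theorem SimLE.refl (P : PAut.{u} I E) : SimLE P P :=
  .of_map id (by simp) (by simp) (by simp)

/-- The greatest simulation relation. -/
def Similar (P Q : PAut.{u} I E) (x : P.State) (ν : FinDist Q.State) : Prop :=
  ∃ S, IsSimRel P Q S ∧ S x ν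

theorem isSimRel_similar (P Q : PAut.{u} I E) : IsSimRel P Q (Similar P Q) where
  step := by
    rintro x a μ' ν hx ⟨S, hS, hν⟩
    obtain ⟨ν', hν', h⟩ := hS.step x a μ' ν hx hν
    exact ⟨ν', hν', h.mono fun y ξ hy => ⟨S, hS, hy⟩⟩
  final := by
    rintro x ν hx ⟨S, hS, hν⟩
    exact hS.final x ν hx hν

@[simp] theorem State_add (P Q : PAut.{u} I E) :
    (P.add Q).State = Option (P.State ⊕ Q.State) := rfl

@[simp] theorem State_seq (P Q : PAut.{u} I E) : (P.seq Q).State = (P.State ⊕ Q.State) := rfl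

@[simp] theorem State_star (P : PAut.{u} I E) : P.star.State = Option P.State := rfl

@[simp] theorem State_choice (p : unitInterval) (P Q : PAut.{u} I E) :
    (choice p P Q).State = (P.State ⊕ Q.State) := rfl

@[simp] theorem State_par (P Q : PAut.{u} I E) : (P.par Q).State = (P.State × Q.State) := rfl

/-! ### Nondeterministic choice -/

theorem add_trans_inl (P Q : PAut.{u} I E) (b : Act I E) (x : P.State) (μ : FinDist P.State)
    (h : P.trans x b μ) : (P.add Q).trans (some (Sum.inl x)) b
      (μ.bind fun y => StdSimplex.single (some (Sum.inl y))) :=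
  map_eq_bind μ (fun y => some (Sum.inl y)) ▸ AddTrans.left h

theorem add_trans_inr (P Q : PAut.{u} I E) (b : Act I E) (x : Q.State) (μ : FinDist Q.State)
    (h : Q.trans x b μ) : (P.add Q).trans (some (Sum.inr x)) b
      (μ.bind fun y => StdSimplex.single (some (Sum.inr y))) :=
  map_eq_bind μ (fun y => some (Sum.inr y)) ▸ AddTrans.right h

theorem add_trans_start_left (P Q : PAut.{u} I E) : (P.add Q).trans none Act.tau
    (P.init.bind fun y => StdSimplex.single (some (Sum.inl y))) :=
  map_eq_bind P.init (fun y => some (Sum.inl y)) ▸ AddTrans.startLeft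

theorem add_trans_start_right (P Q : PAut.{u} I E) : (P.add Q).trans none Act.tau
    (Q.init.bind fun y => StdSimplex.single (some (Sum.inr y))) :=
  map_eq_bind Q.init (fun y => some (Sum.inr y)) ▸ AddTrans.startRight

theorem le_add_left (P Q : PAut.{u} I E) : SimLE P (P.add Q) :=
  .of_kernel (fun x => StdSimplex.single (some (Sum.inl x)))
    (.of_trans (add_trans_start_left P Q))
    (fun _ _ _ hx => .of_trans (add_trans_inl P Q _ _ _ hx))
    fun x hx => .of_mem (Or.inl ⟨x, hx, rfl⟩)

theorem le_add_right (P Q : PAut.{u} I E) : SimLE Q (P.add Q) :=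
  .of_kernel (fun x => StdSimplex.single (some (Sum.inr x)))
    (.of_trans (add_trans_start_right P Q))
    (fun _ _ _ hx => .of_trans (add_trans_inr P Q _ _ _ hx))
    fun x hx => .of_mem (Or.inr ⟨x, hx, rfl⟩)

/-- The fresh state is matched by `R.init`, which has not yet moved and can still reach the start of
either simulation. -/
theorem add_le (hP : SimLE P R) (hQ : SimLE Q R) : SimLE (P.add Q) R := by
  obtain ⟨S, ν, hS, hν, hw⟩ := hP.exists_simRel
  obtain ⟨T, ξ, hT, hξ, hw'⟩ := hQ.exists_simRel
  let U : Option (P.State ⊕ Q.State) → FinDist R.State → Prop := fun s ν => match s with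
    | none => ν = R.init
    | some (Sum.inl x) => S x ν
    | some (Sum.inr y) => T y ν
  have hl {μ : FinDist P.State} {ν : FinDist R.State} (h : Lift S μ ν) :
      Lift U (μ.map fun s => some (Sum.inl s)) ν := by
    rw [map_eq_bind]
    exact h.map_left fun x ξ hx => hx
  have hr {μ : FinDist Q.State} {ν : FinDist R.State} (h : Lift T μ ν) :
      Lift U (μ.map fun s => some (Sum.inr s)) ν := by
    rw [map_eq_bind]
    exact h.map_left fun x ξ hx => hx
  refine IsSimRel.simLE (S := U) ⟨?_, ?_⟩ (.of_rel rfl) (.refl _)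
  · rintro _ a _ ζ (h | h | _ | _) hU
    · obtain ⟨ν', hν', h'⟩ := hS.step _ _ _ _ h hU
      exact ⟨ν', hν', hl h'⟩
    · obtain ⟨ν', hν', h'⟩ := hT.step _ _ _ _ h hU
      exact ⟨ν', hν', hr h'⟩
    · obtain rfl : ζ = R.init := hU
      exact ⟨ν, hw.weakStep, hl hν⟩
    · obtain rfl : ζ = R.init := hU
      exact ⟨ξ, hw'.weakStep, hr hξ⟩
  · rintro _ ζ (⟨x, hx, rfl⟩ | ⟨x, hx, rfl⟩) hU
    · exact hS.final x ζ hx hU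
    · exact hT.final x ζ hx hU

theorem add_mono (hP : SimLE P P') (hQ : SimLE Q Q') : SimLE (P.add Q) (P'.add Q') :=
  add_le (hP.trans (le_add_left _ _)) (hQ.trans (le_add_right _ _))

theorem deadlock_le (P : PAut.{u} I E) : SimLE deadlock P :=
  .of_kernel (fun _ => P.init) (by simpa [deadlock] using Weak.refl _) (fun _ _ _ h => h.elim)
    fun _ h => h.elim

/-! ### Sequential composition -/

theorem seq_trans_inl (P Q : PAut.{u} I E) (b : Act I E) (x : P.State) (μ : FinDist P.State)
    (h : P.trans x b μ) : (P.seq Q).trans (Sum.inl x) b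
      (μ.bind fun y => StdSimplex.single (Sum.inl y)) :=
  map_eq_bind μ (Sum.inl (β := Q.State)) ▸ SeqTrans.left h

theorem seq_trans_inr (P Q : PAut.{u} I E) (b : Act I E) (x : Q.State) (μ : FinDist Q.State)
    (h : Q.trans x b μ) : (P.seq Q).trans (Sum.inr x) b
      (μ.bind fun y => StdSimplex.single (Sum.inr y)) :=
  map_eq_bind μ (Sum.inr (α := P.State)) ▸ SeqTrans.right h

theorem seq_trans_pass {x : P.State} (hx : x ∈ P.final) (Q : PAut.{u} I E) :
    (P.seq Q).trans (Sum.inl x) Act.tau (Q.init.bind fun y => StdSimplex.single (Sum.inr y)) :=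
  map_eq_bind Q.init (Sum.inr (α := P.State)) ▸ SeqTrans.pass hx

theorem seq_init (P Q : PAut.{u} I E) :
    (P.seq Q).init = P.init.bind fun x => StdSimplex.single (Sum.inl x) :=
  map_eq_bind _ _

theorem CanTerminate.seq_pass {μ : FinDist P.State} (h : P.CanTerminate μ) (Q : PAut.{u} I E) :
    (P.seq Q).Weak (μ.bind fun x => StdSimplex.single (Sum.inl x))
      (Q.init.bind fun y => StdSimplex.single (Sum.inr y)) :=
  h.weak_const (seq_trans_inl P Q) fun _ hx => .of_trans (seq_trans_pass hx Q)

/-- A simulation out of a sequential composition, given on both components. -/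
theorem seq_le {S : P.State → FinDist R.State → Prop} {T : Q.State → FinDist R.State → Prop}
    (hS : IsStepSim P R S) (hT : IsSimRel Q R T)
    (hST : ∀ x ν, x ∈ P.final → S x ν → ∃ ν', R.Weak ν ν' ∧ Lift T Q.init ν')
    {ν : FinDist R.State} (hν : Lift S P.init ν) (hw : R.Weak R.init ν) : SimLE (P.seq Q) R := by
  let U : P.State ⊕ Q.State → FinDist R.State → Prop := Sum.elim S T
  have hl {μ : FinDist P.State} {ν : FinDist R.State} (h : Lift S μ ν) :
      Lift U (μ.map Sum.inl) ν := by
    rw [map_eq_bind]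
    exact h.map_left fun x ξ hx => hx
  have hr {μ : FinDist Q.State} {ν : FinDist R.State} (h : Lift T μ ν) :
      Lift U (μ.map Sum.inr) ν := by
    rw [map_eq_bind]
    exact h.map_left fun x ξ hx => hx
  refine IsSimRel.simLE (S := U) ⟨?_, ?_⟩ (hl hν) hw
  · rintro _ a _ ζ (h | h | h) hU
    · obtain ⟨ν', hν', h'⟩ := hS _ _ _ _ h hU
      exact ⟨ν', hν', hl h'⟩
    · obtain ⟨ν', hν', h'⟩ := hT.step _ _ _ _ h hU
      exact ⟨ν', hν', hr h'⟩
    · obtain ⟨ν', hν', h'⟩ := hST _ _ h hU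
      exact ⟨ν', hν'.weakStep, hr h'⟩
  · rintro _ ζ ⟨y, hy, rfl⟩ hU
    exact hT.final y ζ hy hU

/-- The image of a relation under a map of automata that preserves transitions. -/
theorem IsStepSim.map {S : P.State → FinDist Q.State → Prop} (hS : IsStepSim P Q S)
    {f : Q.State → R.State}
    (hf : ∀ b x μ, Q.trans x b μ → R.trans (f x) b (μ.bind fun y => StdSimplex.single (f y))) :
    IsStepSim P R fun x ν => ∃ ξ, S x ξ ∧ ν = ξ.bind fun y => StdSimplex.single (f y) := by
  rintro x a μ _ hx ⟨ξ, hξ, rfl⟩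
  obtain ⟨ν', hν', h'⟩ := hS _ _ _ _ hx hξ
  exact ⟨_, hν'.map hf, by simpa using h'.map (g := id) fun y ζ hy => ⟨ζ, hy, rfl⟩⟩

theorem IsSimRel.map {S : P.State → FinDist Q.State → Prop} (hS : IsSimRel P Q S)
    {f : Q.State → R.State}
    (hf : ∀ b x μ, Q.trans x b μ → R.trans (f x) b (μ.bind fun y => StdSimplex.single (f y)))
    (hF : ∀ x ∈ Q.final, f x ∈ R.final) :
    IsSimRel P R fun x ν => ∃ ξ, S x ξ ∧ ν = ξ.bind fun y => StdSimplex.single (f y) where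
  step := hS.step.map hf
  final := by
    rintro x _ hx ⟨ξ, hξ, rfl⟩
    exact (hS.final x ξ hx hξ).map hf hF

theorem lift_map_single {X Y Z : Type*} {S : X → FinDist Y → Prop} {μ : FinDist X} {ν : FinDist Y}
    (h : Lift S μ ν) (f : Y → Z) :
    Lift (fun x ν => ∃ ξ, S x ξ ∧ ν = ξ.bind fun y => StdSimplex.single (f y)) μ
      (ν.bind fun y => StdSimplex.single (f y)) := by
  simpa using h.map (g := id) fun y ζ hy => ⟨ζ, hy, rfl⟩

theorem seq_mono (hP : SimLE P P') (hQ : SimLE Q Q') : SimLE (P.seq Q) (P'.seq Q') := by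
  obtain ⟨S, ν, hS, hν, hw⟩ := hP.exists_simRel
  obtain ⟨T, ξ, hT, hξ, hw'⟩ := hQ.exists_simRel
  refine seq_le (hS.step.map (seq_trans_inl P' Q'))
    (hT.map (seq_trans_inr P' Q') fun x hx => ⟨x, hx, rfl⟩) ?_ (lift_map_single hν _) ?_
  · rintro x _ hx ⟨ζ, hζ, rfl⟩
    exact ⟨_, ((hS.final x ζ hx hζ).seq_pass Q').trans (hw'.map (seq_trans_inr P' Q')),
      lift_map_single hξ _⟩
  · rw [seq_init]
    exact hw.map (seq_trans_inl P' Q')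

theorem le_seq_skip (P : PAut.{u} I E) : SimLE P (P.seq skip) :=
  .of_kernel (fun x => StdSimplex.single (Sum.inl x)) (seq_init P skip ▸ .refl _)
    (fun _ _ _ h => .of_trans (seq_trans_inl P skip _ _ _ h))
    fun _ hx => .of_weak (.of_trans (seq_trans_pass hx skip)) <| .bind fun y _ =>
      .of_mem ⟨y, trivial, rfl⟩

theorem lift_single {X Y : Type*} (f : X → Y) (μ : FinDist X) :
    Lift (fun x ν => ν = StdSimplex.single (f x)) μ (μ.bind fun y => StdSimplex.single (f y)) :=
  Lift.of_forall μ fun _ _ => .of_rel rfl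

theorem isStepSim_single {f : P.State → Q.State}
    (hf : ∀ b x μ, P.trans x b μ → Q.trans (f x) b (μ.bind fun y => StdSimplex.single (f y))) :
    IsStepSim P Q fun x ν => ν = StdSimplex.single (f x) := by
  rintro x a μ _ hx rfl
  exact ⟨_, .of_trans (hf a x μ hx), lift_single f μ⟩

/-- The state of `skip` only has to remember that `P` has terminated, so it is related to every
distribution that can terminate. -/
theorem seq_skip_le (P : PAut.{u} I E) : SimLE (P.seq skip) P := by
  refine seq_le (T := fun _ ν => P.CanTerminate ν) (isStepSim_single (f := id) (by simp))
    ⟨fun _ _ _ _ h => h.elim, fun _ _ _ h => h⟩ ?_ (lift_single id P.init) (by simpa using .refl _)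
  rintro x _ hx rfl
  exact ⟨_, .refl _, .of_rel (.of_mem hx)⟩

theorem le_skip_seq (P : PAut.{u} I E) : SimLE P (skip.seq P) :=
  .of_kernel (fun x => StdSimplex.single (Sum.inr x))
    (by
      rw [seq_init]
      simpa [skip] using Weak.of_trans (seq_trans_pass (P := skip) (x := PUnit.unit) trivial P))
    (fun _ _ _ h => .of_trans (seq_trans_inr skip P _ _ _ h))
    fun x hx => .of_mem ⟨x, hx, rfl⟩

theorem skip_seq_le (P : PAut.{u} I E) : SimLE (skip.seq P) P := by
  refine seq_le (S := fun _ ν => ν = P.init) (fun _ _ _ _ h => h.elim)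
    ⟨isStepSim_single (f := id) (by simp), ?_⟩ ?_ (.of_rel rfl) (.refl _)
  · rintro x _ hx rfl
    exact .of_mem hx
  · rintro x _ - rfl
    exact ⟨P.init, .refl _, by simpa using lift_single id P.init⟩

theorem deadlock_seq_le (P : PAut.{u} I E) : SimLE (deadlock.seq P) deadlock :=
  seq_le (S := fun _ _ => True) (T := fun _ _ => False) (fun _ _ _ _ h => h.elim)
    ⟨fun _ _ _ _ _ h => h.elim, fun _ _ _ h => h.elim⟩ (fun _ _ h => h.elim)
    (.of_rel trivial) (.refl _)

theorem seq_assoc_le (P Q R : PAut.{u} I E) : SimLE (P.seq (Q.seq R)) ((P.seq Q).seq R) := by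
  refine .of_map (Sum.elim (fun x => Sum.inl (Sum.inl x))
    (Sum.elim (fun y => Sum.inl (Sum.inr y)) Sum.inr)) (by simp [seq_init]) ?_ ?_
  · rintro _ _ _ (h | (h | h | h) | h)
    · simpa using seq_trans_inl _ R _ _ _ (seq_trans_inl P Q _ _ _ h)
    · simpa using seq_trans_inl _ R _ _ _ (seq_trans_inr P Q _ _ _ h)
    · simpa using seq_trans_inr (P.seq Q) R _ _ _ h
    · simpa using seq_trans_pass (P := P.seq Q) (x := Sum.inr _) ⟨_, h, rfl⟩ R
    · simpa [seq_init] using seq_trans_inl _ R _ _ _ (seq_trans_pass h Q)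
  · rintro _ ⟨_, ⟨z, hz, rfl⟩, rfl⟩
    exact ⟨z, hz, rfl⟩

theorem seq_assoc_ge (P Q R : PAut.{u} I E) : SimLE ((P.seq Q).seq R) (P.seq (Q.seq R)) := by
  refine .of_map (Sum.elim (Sum.elim Sum.inl fun y => Sum.inr (Sum.inl y))
    fun z => Sum.inr (Sum.inr z)) (by simp [seq_init]) ?_ ?_
  · rintro _ _ _ ((h | h | h) | h | h)
    · simpa using seq_trans_inl P (Q.seq R) _ _ _ h
    · simpa using seq_trans_inr P _ _ _ _ (seq_trans_inl Q R _ _ _ h)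
    · simpa [seq_init] using seq_trans_pass h (Q.seq R)
    · simpa using seq_trans_inr P _ _ _ _ (seq_trans_inr Q R _ _ _ h)
    · obtain ⟨y, hy, rfl⟩ := h
      simpa using seq_trans_inr P _ _ _ _ (seq_trans_pass hy R)
  · rintro _ ⟨z, hz, rfl⟩
    exact ⟨_, ⟨z, hz, rfl⟩, rfl⟩

/-- The target contains two copies of `R`. A state of the single copy on the left is therefore
related to both, and the summand that was entered decides which one is used. -/
theorem add_seq_le (P Q R : PAut.{u} I E) :
    SimLE ((P.add Q).seq R) ((P.seq R).add (Q.seq R)) := by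
  let f : Option (P.State ⊕ Q.State) → ((P.seq R).add (Q.seq R)).State :=
    Option.map (Sum.map Sum.inl Sum.inl)
  let T (r : R.State) (ν : FinDist ((P.seq R).add (Q.seq R)).State) : Prop :=
    ν = StdSimplex.single (some (Sum.inl (Sum.inr r))) ∨
    ν = StdSimplex.single (some (Sum.inr (Sum.inr r)))
  have hTl (μ : FinDist R.State) :
      Lift T μ (μ.bind fun r => StdSimplex.single (some (Sum.inl (Sum.inr r)))) :=
    Lift.of_forall μ fun r _ => .of_rel (Or.inl rfl)
  have hTr (μ : FinDist R.State) :
      Lift T μ (μ.bind fun r => StdSimplex.single (some (Sum.inr (Sum.inr r)))) :=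
    Lift.of_forall μ fun r _ => .of_rel (Or.inr rfl)
  refine seq_le (S := fun s ν => ν = StdSimplex.single (f s)) (T := T) (isStepSim_single ?_)
    ⟨?_, ?_⟩ ?_ (.of_rel rfl) (.refl _)
  · rintro _ _ _ (h | h | _ | _)
    · simpa [f] using add_trans_inl _ (Q.seq R) _ _ _ (seq_trans_inl P R _ _ _ h)
    · simpa [f] using add_trans_inr (P.seq R) _ _ _ _ (seq_trans_inl Q R _ _ _ h)
    · simpa [f, seq_init] using add_trans_start_left (P.seq R) (Q.seq R)
    · simpa [f, seq_init] using add_trans_start_right (P.seq R) (Q.seq R)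
  · rintro r a μ _ hr (rfl | rfl)
    · exact ⟨_, .of_trans (add_trans_inl _ (Q.seq R) _ _ _ (seq_trans_inr P R _ _ _ hr)),
        by simpa using hTl μ⟩
    · exact ⟨_, .of_trans (add_trans_inr (P.seq R) _ _ _ _ (seq_trans_inr Q R _ _ _ hr)),
        by simpa using hTr μ⟩
  · rintro r _ hr (rfl | rfl)
    · exact .of_mem (Or.inl ⟨_, ⟨r, hr, rfl⟩, rfl⟩)
    · exact .of_mem (Or.inr ⟨_, ⟨r, hr, rfl⟩, rfl⟩)
  · rintro _ _ (⟨x, hx, rfl⟩ | ⟨x, hx, rfl⟩) rfl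
    · exact ⟨_, .of_trans (add_trans_inl _ (Q.seq R) _ _ _ (seq_trans_pass hx R)),
        by simpa using hTl R.init⟩
    · exact ⟨_, .of_trans (add_trans_inr (P.seq R) _ _ _ _ (seq_trans_pass hx R)),
        by simpa using hTr R.init⟩

/-! ### Kleene star -/

theorem star_trans_some (P : PAut.{u} I E) (b : Act I E) (x : P.State) (μ : FinDist P.State)
    (h : P.trans x b μ) : P.star.trans (some x) b (μ.bind fun y => StdSimplex.single (some y)) :=
  map_eq_bind μ some ▸ StarTrans.inner h

theorem star_trans_start (P : PAut.{u} I E) :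
    P.star.trans none Act.tau (P.init.bind fun y => StdSimplex.single (some y)) :=
  map_eq_bind P.init some ▸ StarTrans.start

theorem star_trans_back {x : P.State} (hx : x ∈ P.final) :
    P.star.trans (some x) Act.tau (StdSimplex.single none) :=
  StarTrans.back hx

theorem CanTerminate.star_back {μ : FinDist P.State} (h : P.CanTerminate μ) :
    P.star.Weak (μ.bind fun x => StdSimplex.single (some x)) (StdSimplex.single none) :=
  h.weak_const (star_trans_some P) fun _ hx => .of_trans (star_trans_back hx)

@[simp] theorem star_init (P : PAut.{u} I E) : P.star.init = StdSimplex.single none := rfl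

/-- A relation on `P*` given by a relation on the new state and a relation on the old states. -/
def starRel (S : P.State → FinDist R.State → Prop) (Z : FinDist R.State → Prop)
    (s : Option P.State) (ν : FinDist R.State) : Prop :=
  s.elim (Z ν) fun x => S x ν

theorem lift_starRel {S : P.State → FinDist R.State → Prop} {Z : FinDist R.State → Prop}
    {μ : FinDist P.State} {ν : FinDist R.State} (h : Lift S μ ν) :
    Lift (starRel S Z) (μ.bind fun x => StdSimplex.single (some x)) ν :=
  h.map_left fun _ _ hx => hx

theorem isStepSim_starRel {S : P.State → FinDist R.State → Prop} {Z : FinDist R.State → Prop}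
    (hS : IsStepSim P R S) (hstart : ∀ ν, Z ν → ∃ ν', R.Weak ν ν' ∧ Lift S P.init ν')
    (hback : ∀ x ν, x ∈ P.final → S x ν → ∃ ν', R.Weak ν ν' ∧ Z ν') :
    IsStepSim P.star R (starRel S Z) := by
  rintro _ a _ ν (h | _ | h) hU
  · obtain ⟨ν', hν', h'⟩ := hS _ _ _ _ h hU
    exact ⟨ν', hν', by simpa using lift_starRel h'⟩
  · obtain ⟨ν', hν', h'⟩ := hstart ν hU
    exact ⟨ν', hν'.weakStep, by simpa using lift_starRel h'⟩
  · obtain ⟨ν', hν', h'⟩ := hback _ _ h hU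
    exact ⟨ν', hν'.weakStep, .of_rel h'⟩

theorem star_le {S : P.State → FinDist R.State → Prop} {Z : FinDist R.State → Prop}
    (hS : IsStepSim P R S) (hstart : ∀ ν, Z ν → ∃ ν', R.Weak ν ν' ∧ Lift S P.init ν')
    (hback : ∀ x ν, x ∈ P.final → S x ν → ∃ ν', R.Weak ν ν' ∧ Z ν')
    (hfinal : ∀ ν, Z ν → R.CanTerminate ν) (hinit : Z R.init) : SimLE P.star R := by
  refine IsSimRel.simLE (S := starRel S Z) ⟨isStepSim_starRel hS hstart hback, ?_⟩
    (.of_rel hinit) (.refl _)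
  rintro _ ν rfl hU
  exact hfinal ν hU

theorem star_mono (hP : SimLE P P') : SimLE P.star P'.star := by
  obtain ⟨S, ν, hS, hν, hw⟩ := hP.exists_simRel
  refine star_le (hS.step.map (star_trans_some P')) (Z := fun ν => ν = StdSimplex.single none)
    ?_ ?_ ?_ rfl
  · rintro _ rfl
    exact ⟨_, (Weak.of_trans (star_trans_start P')).trans (hw.map (star_trans_some P')),
      lift_map_single hν _⟩
  · rintro x _ hx ⟨ξ, hξ, rfl⟩
    exact ⟨_, (hS.final x ξ hx hξ).star_back, rfl⟩
  · rintro _ rfl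
    exact .of_mem rfl

theorem skip_le_star (P : PAut.{u} I E) : SimLE skip P.star :=
  .of_map (fun _ => none) (by simp [skip, star]) (fun _ _ _ h => h.elim) fun _ _ => rfl

theorem seq_star_le_star (P : PAut.{u} I E) : SimLE (P.seq P.star) P.star := by
  let h : P.State ⊕ Option P.State → FinDist (Option P.State) :=
    Sum.elim (fun x => StdSimplex.single (some x)) fun s => StdSimplex.single s
  have hr (ν : FinDist (Option P.State)) : FinDist.bind (StdSimplex.map Sum.inr ν) h = ν := by
    simp [h]
  refine .of_kernel h ?_ ?_ ?_
  · simpa [seq_init, h] using Weak.of_trans (star_trans_start P)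
  · rintro _ _ _ (hx | @⟨s, _, ν, hx⟩ | hx)
    · simpa [h] using WeakStep.of_trans (star_trans_some P _ _ _ hx)
    · exact (hr ν).symm ▸ WeakStep.of_trans (P := P.star) hx
    · exact (hr P.star.init).symm ▸ WeakStep.of_trans (star_trans_back hx)
  · rintro _ ⟨s, hs, rfl⟩
    exact .of_mem hs

theorem skip_add_seq_star_le_star (P : PAut.{u} I E) : SimLE (skip.add (P.seq P.star)) P.star :=
  add_le (skip_le_star P) (seq_star_le_star P)

/-- The first round runs in the left factor of `P · P*` and later rounds inside `P*`, so each state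
of `P` has two matches. The loop state is matched by the fresh state of the sum before the first
round and by the inner loop state afterwards. -/
theorem star_le_skip_add_seq_star (P : PAut.{u} I E) :
    SimLE P.star (skip.add (P.seq P.star)) := by
  have hr := add_trans_inr skip (P.seq P.star)
  have hfst (b : Act I E) (x : P.State) (μ : FinDist P.State) (h : P.trans x b μ) :
      (skip.add (P.seq P.star)).trans (some (Sum.inr (Sum.inl x))) b
        (μ.bind fun y => StdSimplex.single (some (Sum.inr (Sum.inl y)))) := by
    simpa using hr _ _ _ (seq_trans_inl P P.star _ _ _ h)
  have hsnd (b : Act I E) (x : P.State) (μ : FinDist P.State) (h : P.trans x b μ) :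
      (skip.add (P.seq P.star)).trans (some (Sum.inr (Sum.inr (some x)))) b
        (μ.bind fun y => StdSimplex.single (some (Sum.inr (Sum.inr (some y))))) := by
    simpa using hr _ _ _ (seq_trans_inr P P.star _ _ _ (star_trans_some P _ _ _ h))
  let S (x : P.State) (ν : FinDist (skip.add (P.seq P.star)).State) : Prop :=
    ν = StdSimplex.single (some (Sum.inr (Sum.inl x))) ∨
    ν = StdSimplex.single (some (Sum.inr (Sum.inr (some x))))
  let Z (ν : FinDist (skip.add (P.seq P.star)).State) : Prop :=
    ν = StdSimplex.single none ∨ ν = StdSimplex.single (some (Sum.inr (Sum.inr none)))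
  have hSfst (μ : FinDist P.State) :
      Lift S μ (μ.bind fun y => StdSimplex.single (some (Sum.inr (Sum.inl y)))) :=
    Lift.of_forall μ fun x _ => .of_rel (Or.inl rfl)
  have hSsnd (μ : FinDist P.State) :
      Lift S μ (μ.bind fun y => StdSimplex.single (some (Sum.inr (Sum.inr (some y))))) :=
    Lift.of_forall μ fun x _ => .of_rel (Or.inr rfl)
  refine star_le (S := S) (Z := Z) ?_ ?_ ?_ ?_ (Or.inl rfl)
  · rintro x a μ _ hx (rfl | rfl)
    · exact ⟨_, .of_trans (hfst _ _ _ hx), hSfst μ⟩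
    · exact ⟨_, .of_trans (hsnd _ _ _ hx), hSsnd μ⟩
  · rintro _ (rfl | rfl)
    · exact ⟨_, .of_trans (add_trans_start_right skip (P.seq P.star)),
        by simpa [seq_init] using hSfst P.init⟩
    · exact ⟨_, .of_trans (hr _ _ _ (seq_trans_inr P P.star _ _ _ (star_trans_start P))),
        by simpa using hSsnd P.init⟩
  · rintro x _ hx (rfl | rfl)
    · refine ⟨_, .of_trans (hr _ _ _ (seq_trans_pass hx P.star)), Or.inr ?_⟩
      exact (congrArg (FinDist.bind · _) (single_bind _ _)).trans (single_bind _ _)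
    · refine ⟨_, .of_trans (hr _ _ _ (seq_trans_inr P P.star _ _ _ (star_trans_back hx))),
        Or.inr ?_⟩
      exact (congrArg (FinDist.bind · _) (single_bind _ _)).trans (single_bind _ _)
  · rintro _ (rfl | rfl)
    · refine .of_weak (.of_trans (add_trans_start_left skip (P.seq P.star))) ?_
      exact .bind fun x _ => .of_mem (Or.inl ⟨x, trivial, rfl⟩)
    · exact .of_mem (Or.inr ⟨_, ⟨none, rfl, rfl⟩, rfl⟩)

/-- The kernel over the image is precomposed with `f`. This restricts a simulation of a compound
automaton to one of its parts. -/
theorem lift_of_lift_map {X X' Y : Type*} {S : X' → FinDist Y → Prop} {f : X → X'}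
    {μ : FinDist X} {ν : FinDist Y} (h : Lift S (StdSimplex.map f μ) ν) :
    Lift (fun x => S (f x)) μ ν := by
  rw [map_eq_bind] at h
  obtain ⟨κ, hκ, rfl⟩ := h.exists_kernel
  simpa using Lift.of_kernel (S := fun x => S (f x)) (fun x => κ (f x)) fun x hx ξ hξ =>
    hκ _ (weights_bind_ne_zero.2 ⟨x, hx, weights_single_ne_zero.2 rfl⟩) ξ hξ

/-- The loop state is related to the distributions that simulate `Q.init`. After a round these need
not be `Q.init` itself, so `S` is composed with the greatest simulation of `Q` by itself; leaving
the loop then needs no move. -/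
theorem star_seq_le (h : SimLE (P.seq Q) Q) : SimLE (P.star.seq Q) Q := by
  obtain ⟨S, ν, hS, hν, hw⟩ := h.exists_simRel
  have hT := isSimRel_similar Q Q
  let C (s : P.State ⊕ Q.State) (ζ : FinDist Q.State) : Prop :=
    ∃ ξ, S s ξ ∧ Lift (Similar Q Q) ξ ζ
  have hC : IsSimRel (P.seq Q) Q C := hS.comp hT
  have hl : IsStepSim P Q fun x => C (Sum.inl x) := by
    intro x a μ ξ hx hξ
    obtain ⟨ξ', hξ', h'⟩ := hC.step _ _ _ _ (SeqTrans.left hx) hξ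
    exact ⟨ξ', hξ', lift_of_lift_map h'⟩
  have hr : IsSimRel Q Q fun y => C (Sum.inr y) := by
    refine ⟨?_, fun y ξ hy hξ => hC.final _ _ ⟨y, hy, rfl⟩ hξ⟩
    intro y a μ ξ hy hξ
    obtain ⟨ξ', hξ', h'⟩ := hC.step _ _ _ _ (SeqTrans.right hy) hξ
    exact ⟨ξ', hξ', lift_of_lift_map h'⟩
  have hid : Lift (Similar Q Q) Q.init Q.init := by
    have hsim : IsSimRel Q Q fun x ν => ν = StdSimplex.single x := by
      refine ⟨isStepSim_single (f := id) (by simp), ?_⟩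
      rintro x _ hx rfl
      exact .of_mem hx
    simpa only [id, bind_single] using
      (lift_single id Q.init).mono (T := Similar Q Q) fun x ξ hξ => ⟨_, hsim, hξ⟩
  refine seq_le (isStepSim_starRel hl (Z := Lift (Similar Q Q) Q.init) ?_ ?_) hT ?_
    (.of_rel hid) (.refl _)
  · intro ζ hζ
    -- `Q.init` weakly reaches a match for the start of `P · Q`, and `ζ` imitates that move.
    obtain ⟨ζ', hζ', h'⟩ := hT.lift_weak hζ hw
    exact ⟨ζ', hζ', lift_of_lift_map (lift_comp hν h')⟩
  · intro x ζ hx hζ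
    -- The return to the loop is answered like the passage from `P` to `Q`. Since `C` restricted to
    -- `Q` is itself a simulation relation, the answer again simulates `Q.init`.
    obtain ⟨ζ', hζ', h'⟩ := hC.step _ _ _ _ (SeqTrans.pass hx) hζ
    exact ⟨ζ', hζ'.weak, (lift_of_lift_map h').mono fun y ξ hξ => ⟨_, hr, hξ⟩⟩
  · rintro _ ζ rfl hζ
    exact ⟨ζ, .refl ζ, hζ⟩

/-! ### Probabilistic choice -/

theorem choice_trans_inl (p : unitInterval) (P Q : PAut.{u} I E) (b : Act I E) (x : P.State)
    (μ : FinDist P.State) (h : P.trans x b μ) : (choice p P Q).trans (Sum.inl x) b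
      (μ.bind fun y => StdSimplex.single (Sum.inl y)) :=
  map_eq_bind μ (Sum.inl (β := Q.State)) ▸ ChoiceTrans.left h

theorem choice_trans_inr (p : unitInterval) (P Q : PAut.{u} I E) (b : Act I E) (x : Q.State)
    (μ : FinDist Q.State) (h : Q.trans x b μ) : (choice p P Q).trans (Sum.inr x) b
      (μ.bind fun y => StdSimplex.single (Sum.inr y)) :=
  map_eq_bind μ (Sum.inr (α := P.State)) ▸ ChoiceTrans.right h

theorem choice_init (p : unitInterval) (P Q : PAut.{u} I E) : (choice p P Q).init =
    mix p (P.init.bind fun x => StdSimplex.single (Sum.inl x))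
      (Q.init.bind fun x => StdSimplex.single (Sum.inr x)) := by
  simp [choice]

/-- A simulation out of a probabilistic choice, given on both components. -/
theorem choice_le {p : unitInterval} {S : P.State → FinDist R.State → Prop}
    {T : Q.State → FinDist R.State → Prop} (hS : IsSimRel P R S) (hT : IsSimRel Q R T)
    {ν ξ : FinDist R.State} (hν : Lift S P.init ν) (hξ : Lift T Q.init ξ)
    (hw : R.Weak R.init (mix p ν ξ)) : SimLE (choice p P Q) R := by
  let U : P.State ⊕ Q.State → FinDist R.State → Prop := Sum.elim S T
  have hl {μ : FinDist P.State} {ν : FinDist R.State} (h : Lift S μ ν) :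
      Lift U (μ.map Sum.inl) ν := by
    rw [map_eq_bind]
    exact h.map_left fun x ξ hx => hx
  have hr {μ : FinDist Q.State} {ν : FinDist R.State} (h : Lift T μ ν) :
      Lift U (μ.map Sum.inr) ν := by
    rw [map_eq_bind]
    exact h.map_left fun x ξ hx => hx
  refine IsSimRel.simLE (S := U) ⟨?_, ?_⟩ ((convexRel_lift U).mix p (hl hν) (hr hξ)) hw
  · rintro _ a _ ζ (h | h) hU
    · obtain ⟨ν', hν', h'⟩ := hS.step _ _ _ _ h hU
      exact ⟨ν', hν', hl h'⟩
    · obtain ⟨ν', hν', h'⟩ := hT.step _ _ _ _ h hU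
      exact ⟨ν', hν', hr h'⟩
  · rintro _ ζ (⟨x, hx, rfl⟩ | ⟨x, hx, rfl⟩) hU
    · exact hS.final x ζ hx hU
    · exact hT.final x ζ hx hU

theorem choice_mono (p : unitInterval) (hP : SimLE P P') (hQ : SimLE Q Q') :
    SimLE (choice p P Q) (choice p P' Q') := by
  obtain ⟨S, ν, hS, hν, hw⟩ := hP.exists_simRel
  obtain ⟨T, ξ, hT, hξ, hw'⟩ := hQ.exists_simRel
  refine choice_le (hS.map (choice_trans_inl p P' Q') fun x hx => Or.inl ⟨x, hx, rfl⟩)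
    (hT.map (choice_trans_inr p P' Q') fun x hx => Or.inr ⟨x, hx, rfl⟩)
    (lift_map_single hν _) (lift_map_single hξ _) ?_
  rw [choice_init]
  exact (convexRel_weak _).mix p (hw.map (choice_trans_inl p P' Q'))
    (hw'.map (choice_trans_inr p P' Q'))

theorem choice_self_le (p : unitInterval) (P : PAut.{u} I E) : SimLE (choice p P P) P := by
  refine .of_map (Sum.elim id id) (by simp [choice_init]) ?_ ?_
  · rintro _ _ _ (h | h) <;> simpa using h
  · rintro _ (⟨x, hx, rfl⟩ | ⟨x, hx, rfl⟩) <;> exact hx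

/-- Each state is matched by the mixture of its two copies, which move simultaneously by convexity
of weak steps. -/
theorem le_choice_self (p : unitInterval) (P : PAut.{u} I E) : SimLE P (choice p P P) := by
  refine .of_kernel
    (fun x => mix p (StdSimplex.single (Sum.inl x)) (StdSimplex.single (Sum.inr x))) ?_ ?_ ?_
  · simpa [choice_init] using Weak.refl _
  · intro x a μ hx
    rw [bind_mix]
    exact (convexRel_weakStep _ a).mix p (.of_trans (choice_trans_inl p P P _ _ _ hx))
      (.of_trans (choice_trans_inr p P P _ _ _ hx))
  · intro x hx
    exact .mix p (.of_mem (Or.inl ⟨x, hx, rfl⟩)) (.of_mem (Or.inr ⟨x, hx, rfl⟩))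

theorem choice_symm_le (p : unitInterval) (P Q : PAut.{u} I E) :
    SimLE (choice p P Q) (choice (unitInterval.symm p) Q P) := by
  refine .of_map Sum.swap (by simp [choice_init, mix_symm]) ?_ ?_
  · rintro _ _ _ (h | h)
    · simpa using choice_trans_inr (unitInterval.symm p) Q P _ _ _ h
    · simpa using choice_trans_inl (unitInterval.symm p) Q P _ _ _ h
  · rintro _ (⟨x, hx, rfl⟩ | ⟨x, hx, rfl⟩)
    exacts [Or.inr ⟨x, hx, rfl⟩, Or.inl ⟨x, hx, rfl⟩]

theorem choice_assoc_le {p q p' q' : unitInterval} (h₁ : (p' * q' : ℝ) = p)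
    (h₂ : ((1 - p') * q' : ℝ) = (1 - p) * q) (h₃ : (1 - q' : ℝ) = (1 - p) * (1 - q))
    (P Q R : PAut.{u} I E) :
    SimLE (choice p P (choice q Q R)) (choice q' (choice p' P Q) R) := by
  refine .of_map (Sum.elim (fun x => Sum.inl (Sum.inl x))
    (Sum.elim (fun y => Sum.inl (Sum.inr y)) Sum.inr)) ?_ ?_ ?_
  · simpa [choice_init] using (mix_assoc h₁ h₂ h₃ _ _ _).symm
  · rintro _ _ _ (h | (h | h))
    · simpa using choice_trans_inl q' _ R _ _ _ (choice_trans_inl p' P Q _ _ _ h)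
    · simpa using choice_trans_inl q' _ R _ _ _ (choice_trans_inr p' P Q _ _ _ h)
    · simpa using choice_trans_inr q' (choice p' P Q) R _ _ _ h
  · rintro _ (⟨x, hx, rfl⟩ | ⟨_, ⟨x, hx, rfl⟩ | ⟨x, hx, rfl⟩, rfl⟩)
    exacts [Or.inl ⟨_, Or.inl ⟨x, hx, rfl⟩, rfl⟩, Or.inl ⟨_, Or.inr ⟨x, hx, rfl⟩, rfl⟩,
      Or.inr ⟨x, hx, rfl⟩]

theorem choice_assoc_ge {p q p' q' : unitInterval} (h₁ : (p' * q' : ℝ) = p)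
    (h₂ : ((1 - p') * q' : ℝ) = (1 - p) * q) (h₃ : (1 - q' : ℝ) = (1 - p) * (1 - q))
    (P Q R : PAut.{u} I E) :
    SimLE (choice q' (choice p' P Q) R) (choice p P (choice q Q R)) := by
  refine .of_map (Sum.elim (Sum.elim Sum.inl fun y => Sum.inr (Sum.inl y))
    fun z => Sum.inr (Sum.inr z)) ?_ ?_ ?_
  · simpa [choice_init] using mix_assoc h₁ h₂ h₃ _ _ _
  · rintro _ _ _ ((h | h) | h)
    · simpa using choice_trans_inl p P (choice q Q R) _ _ _ h
    · simpa using choice_trans_inr p P _ _ _ _ (choice_trans_inl q Q R _ _ _ h)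
    · simpa using choice_trans_inr p P _ _ _ _ (choice_trans_inr q Q R _ _ _ h)
  · rintro _ (⟨_, ⟨x, hx, rfl⟩ | ⟨x, hx, rfl⟩, rfl⟩ | ⟨x, hx, rfl⟩)
    exacts [Or.inl ⟨x, hx, rfl⟩, Or.inr ⟨_, Or.inl ⟨x, hx, rfl⟩, rfl⟩,
      Or.inr ⟨_, Or.inr ⟨x, hx, rfl⟩, rfl⟩]

theorem choice_seq_ge (p : unitInterval) (P Q R : PAut.{u} I E) :
    SimLE (choice p (P.seq R) (Q.seq R)) ((choice p P Q).seq R) := by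
  refine .of_map (Sum.elim (Sum.map Sum.inl id) (Sum.map Sum.inr id)) ?_ ?_ ?_
  · simp [choice_init, seq_init]
  · rintro _ _ _ ((h | h | h) | (h | h | h))
    · simpa using seq_trans_inl _ R _ _ _ (choice_trans_inl p P Q _ _ _ h)
    · simpa using seq_trans_inr (choice p P Q) R _ _ _ h
    · simpa using seq_trans_pass (P := choice p P Q) (Or.inl ⟨_, h, rfl⟩) R
    · simpa using seq_trans_inl _ R _ _ _ (choice_trans_inr p P Q _ _ _ h)
    · simpa using seq_trans_inr (choice p P Q) R _ _ _ h
    · simpa using seq_trans_pass (P := choice p P Q) (Or.inr ⟨_, h, rfl⟩) R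
  · rintro _ (⟨_, ⟨x, hx, rfl⟩, rfl⟩ | ⟨_, ⟨x, hx, rfl⟩, rfl⟩) <;> exact ⟨x, hx, rfl⟩

theorem choice_seq_le (p : unitInterval) (P Q R : PAut.{u} I E) :
    SimLE ((choice p P Q).seq R) (choice p (P.seq R) (Q.seq R)) := by
  have hl := choice_trans_inl p (P.seq R) (Q.seq R)
  have hr := choice_trans_inr p (P.seq R) (Q.seq R)
  let f : P.State ⊕ Q.State → (choice p (P.seq R) (Q.seq R)).State := Sum.map Sum.inl Sum.inl
  let T (r : R.State) (ν : FinDist (choice p (P.seq R) (Q.seq R)).State) : Prop :=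
    ν = StdSimplex.single (Sum.inl (Sum.inr r)) ∨ ν = StdSimplex.single (Sum.inr (Sum.inr r))
  have hTl (μ : FinDist R.State) :
      Lift T μ (μ.bind fun r => StdSimplex.single (Sum.inl (Sum.inr r))) :=
    Lift.of_forall μ fun r _ => .of_rel (Or.inl rfl)
  have hTr (μ : FinDist R.State) :
      Lift T μ (μ.bind fun r => StdSimplex.single (Sum.inr (Sum.inr r))) :=
    Lift.of_forall μ fun r _ => .of_rel (Or.inr rfl)
  refine seq_le (S := fun s ν => ν = StdSimplex.single (f s)) (T := T) (isStepSim_single ?_)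
    ⟨?_, ?_⟩ ?_ (lift_single f _) ?_
  · rintro _ _ _ (h | h)
    · simpa [f] using hl _ _ _ (seq_trans_inl P R _ _ _ h)
    · simpa [f] using hr _ _ _ (seq_trans_inl Q R _ _ _ h)
  · rintro r a μ _ h (rfl | rfl)
    · exact ⟨_, .of_trans (hl _ _ _ (seq_trans_inr P R _ _ _ h)), by simpa using hTl μ⟩
    · exact ⟨_, .of_trans (hr _ _ _ (seq_trans_inr Q R _ _ _ h)), by simpa using hTr μ⟩
  · rintro r _ h (rfl | rfl)
    · exact .of_mem (Or.inl ⟨_, ⟨r, h, rfl⟩, rfl⟩)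
    · exact .of_mem (Or.inr ⟨_, ⟨r, h, rfl⟩, rfl⟩)
  · rintro _ _ (⟨x, hx, rfl⟩ | ⟨x, hx, rfl⟩) rfl
    · exact ⟨_, .of_trans (hl _ _ _ (seq_trans_pass hx R)), by simpa using hTl R.init⟩
    · exact ⟨_, .of_trans (hr _ _ _ (seq_trans_pass hx R)), by simpa using hTr R.init⟩
  · simpa [choice_init, seq_init, f] using Weak.refl _

/-- On the right the coin is tossed before `P` runs. The mixture of the two copies of a state of `P`
carries that outcome along until the passage to `Q` or `R`. -/
theorem seq_choice_le (p : unitInterval) (P Q R : PAut.{u} I E) :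
    SimLE (P.seq (choice p Q R)) (choice p (P.seq Q) (P.seq R)) := by
  have hl := choice_trans_inl p (P.seq Q) (P.seq R)
  have hr := choice_trans_inr p (P.seq Q) (P.seq R)
  refine .of_kernel (Sum.elim (fun x => mix p (StdSimplex.single (Sum.inl (Sum.inl x)))
      (StdSimplex.single (Sum.inr (Sum.inl x))))
    (Sum.elim (fun y => StdSimplex.single (Sum.inl (Sum.inr y)))
      fun z => StdSimplex.single (Sum.inr (Sum.inr z)))) ?_ ?_ ?_
  · simpa [choice_init, seq_init] using Weak.refl _
  · rintro _ a _ (h | (h | h) | h)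
    · simpa using (convexRel_weakStep _ a).mix p
        (.of_trans (hl _ _ _ (seq_trans_inl P Q _ _ _ h)))
        (.of_trans (hr _ _ _ (seq_trans_inl P R _ _ _ h)))
    · simpa using WeakStep.of_trans (hl _ _ _ (seq_trans_inr P Q _ _ _ h))
    · simpa using WeakStep.of_trans (hr _ _ _ (seq_trans_inr P R _ _ _ h))
    · simpa [choice_init] using (convexRel_weakStep _ _).mix p
        (.of_trans (hl _ _ _ (seq_trans_pass h Q)))
        (.of_trans (hr _ _ _ (seq_trans_pass h R)))
  · rintro _ ⟨_, ⟨y, hy, rfl⟩ | ⟨y, hy, rfl⟩, rfl⟩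
    · exact .of_mem (Or.inl ⟨_, ⟨y, hy, rfl⟩, rfl⟩)
    · exact .of_mem (Or.inr ⟨_, ⟨y, hy, rfl⟩, rfl⟩)

/-! ### Parallel composition -/

theorem tau_notMem_external : (Act.tau : Act I E) ∉ Act.external '' (Set.univ : Set E) := by
  simp

theorem par_trans_sync (ha : a ∈ Act.external '' (Set.univ : Set E)) {x : P.State} {y : Q.State}
    {μ : FinDist P.State} {ν : FinDist Q.State} (hx : P.trans x a μ) (hy : Q.trans y a ν) :
    (P.par Q).trans (x, y) a (μ.bind fun x' => ν.bind fun y' => StdSimplex.single (x', y')) :=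
  prod_eq_bind μ ν ▸ ParTrans.sync ha hx hy

theorem par_trans_left (ha : a ∉ Act.external '' (Set.univ : Set E)) {x : P.State}
    {μ : FinDist P.State} (hx : P.trans x a μ) (y : Q.State) :
    (P.par Q).trans (x, y) a (μ.bind fun x' => StdSimplex.single (x', y)) := by
  have : (P.par Q).trans (x, y) a (μ.prod (dirac y)) := ParTrans.left ha hx
  simpa using this

theorem par_trans_right (ha : a ∉ Act.external '' (Set.univ : Set E)) {y : Q.State}
    {ν : FinDist Q.State} (hy : Q.trans y a ν) (x : P.State) :
    (P.par Q).trans (x, y) a (ν.bind fun y' => StdSimplex.single (x, y')) := by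
  have : (P.par Q).trans (x, y) a (FinDist.prod (dirac x) ν) := ParTrans.right ha hy
  simpa using this

theorem par_init (P Q : PAut.{u} I E) : (P.par Q).init =
    P.init.bind fun x => Q.init.bind fun y => StdSimplex.single (x, y) :=
  prod_eq_bind _ _

theorem Weak.par_left {μ μ' : FinDist P.State} (h : P.Weak μ μ') (ρ : FinDist Q.State) :
    (P.par Q).Weak (μ.bind fun x => ρ.bind fun y => StdSimplex.single (x, y))
      (μ'.bind fun x => ρ.bind fun y => StdSimplex.single (x, y)) := by
  refine h.transport fun x ν hx => ?_
  rw [bind_comm]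
  exact (convexRel_weak _).bind fun y _ => .of_trans (par_trans_left tau_notMem_external hx y)

theorem Weak.par_right {ρ ρ' : FinDist Q.State} (h : Q.Weak ρ ρ') (μ : FinDist P.State) :
    (P.par Q).Weak (μ.bind fun x => ρ.bind fun y => StdSimplex.single (x, y))
      (μ.bind fun x => ρ'.bind fun y => StdSimplex.single (x, y)) :=
  (convexRel_weak _).bind fun x _ => h.transport fun _ _ hy =>
    .of_trans (par_trans_right tau_notMem_external hy x)

theorem par_mono_left (hP : SimLE P P') (Q : PAut.{u} I E) : SimLE (P.par Q) (P'.par Q) := by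
  obtain ⟨S, ν, hS, hν, hw⟩ := hP.exists_simRel
  let U (s : P.State × Q.State) (ζ : FinDist (P'.State × Q.State)) : Prop :=
    ∃ ξ, S s.1 ξ ∧ ζ = ξ.bind fun x => StdSimplex.single (x, s.2)
  have hU {μ : FinDist P.State} {ν : FinDist P'.State} (h : Lift S μ ν) (ρ : FinDist Q.State) :
      Lift U (μ.bind fun x => ρ.bind fun y => StdSimplex.single (x, y))
        (ν.bind fun x => ρ.bind fun y => StdSimplex.single (x, y)) := by
    rw [bind_comm, bind_comm ν]
    -- With `y` drawn first, the lifting of `S` is used separately for each fixed `y`.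
    exact Lift.bind fun y _ => h.map fun x ξ hx => ⟨ξ, hx, rfl⟩
  refine IsSimRel.simLE (S := U) ⟨?_, ?_⟩ (par_init P Q ▸ hU hν Q.init)
    (par_init P' Q ▸ hw.par_left Q.init)
  · rintro _ a _ _ (@⟨x, y, _, μ, η, ha, hx, hy⟩ | @⟨x, y, _, μ, ha, hx⟩ | @⟨x, y, _, η, ha, hy⟩)
      ⟨ξ, hξ, rfl⟩
    · obtain ⟨ξ', ⟨ξ₁, ξ₂, h₁, h₂, h₃⟩, h'⟩ := hS.step _ _ _ _ hx hξ
      -- The silent moves before the visible step run while `y` waits, the visible step synchronises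
      -- with `Q`, and the remaining silent moves run beside `η`. An external action is not silent,
      -- so the visible step cannot idle.
      refine ⟨_, ⟨ξ₁.bind fun z => StdSimplex.single (z, y), _, ?_, ?_, h₃.par_left η⟩,
        by simpa using hU h' η⟩
      · simpa using h₁.par_left (StdSimplex.single y)
      · refine h₂.transport (convexRel_lift _) ?_
        rintro z ζ (hz | ⟨rfl, -⟩)
        · exact .of_rel (Or.inl (par_trans_sync ha hz hy))
        · exact (tau_notMem_external ha).elim
    · obtain ⟨ξ', hξ', h'⟩ := hS.step _ _ _ _ hx hξ
      refine ⟨ξ'.bind fun x => StdSimplex.single (x, y), hξ'.transport ?_ ?_,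
        by simpa using hU h' (StdSimplex.single y)⟩
      · exact fun z ζ hz => .of_trans (par_trans_left tau_notMem_external hz y)
      · exact fun z ζ hz => .of_trans (par_trans_left ha hz y)
    · exact ⟨_, (convexRel_weakStep _ _).bind fun z _ => .of_trans (par_trans_right ha hy z),
        by simpa using hU (.of_rel hξ) η⟩
  · rintro ⟨x, y⟩ _ ⟨hx, hy⟩ ⟨ξ, hξ, rfl⟩
    obtain ⟨ξ', hξ', h'⟩ := hS.final _ _ hx hξ
    refine .of_weak (by simpa using h'.par_left (StdSimplex.single y)) ?_
    exact .bind fun z hz => .of_mem ⟨hξ' (Finsupp.mem_support_iff.2 hz), hy⟩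

theorem par_comm_le (P Q : PAut.{u} I E) : SimLE (P.par Q) (Q.par P) := by
  refine .of_map Prod.swap ?_ ?_ fun _ h => ⟨h.2, h.1⟩
  · simp only [par_init]
    rw [bind_comm]
    simp
  · rintro _ a _ (⟨ha, hx, hy⟩ | ⟨ha, hx⟩ | ⟨ha, hy⟩)
    · simp only [prod_eq_bind]
      rw [bind_comm]
      simpa using par_trans_sync ha hy hx
    · simpa using par_trans_right ha hx _
    · simpa using par_trans_left ha hy _

theorem par_mono (hP : SimLE P P') (hQ : SimLE Q Q') : SimLE (P.par Q) (P'.par Q') :=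
  (par_mono_left hP Q).trans <| (par_comm_le _ _).trans <|
    (par_mono_left hQ P').trans (par_comm_le _ _)

theorem par_assoc_le (P Q R : PAut.{u} I E) : SimLE (P.par (Q.par R)) ((P.par Q).par R) := by
  refine .of_map (fun s => ((s.1, s.2.1), s.2.2)) (by simp [par_init]) ?_
    fun _ h => ⟨⟨h.1, h.2.1⟩, h.2.2⟩
  rintro _ a _ (⟨ha, hx, ⟨-, hy, hz⟩ | ⟨ha', hy⟩ | ⟨ha', hz⟩⟩ | @⟨x, ⟨y, z⟩, _, μ, ha, hx⟩ |
    ⟨ha, ⟨ha', hy, hz⟩ | ⟨-, hy⟩ | ⟨-, hz⟩⟩)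
  · simpa using par_trans_sync ha (par_trans_sync ha hx hy) hz
  · exact (ha' ha).elim
  · exact (ha' ha).elim
  · simpa using par_trans_left ha (par_trans_left ha hx y) z
  · exact (ha ha').elim
  · simpa using par_trans_left ha (par_trans_right ha hy _) _
  · simpa using par_trans_right (P := P.par Q) ha hz _

theorem par_assoc_ge (P Q R : PAut.{u} I E) : SimLE ((P.par Q).par R) (P.par (Q.par R)) :=
  (par_comm_le _ _).trans <| (par_mono (.refl R) (par_comm_le P Q)).trans <|
    (par_assoc_le R Q P).trans <| (par_comm_le _ _).trans (par_mono (.refl P) (par_comm_le R Q))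

/-- The joint passage on the left is matched by two successive silent passages on the right, one in
each component; all other transitions are matched directly. -/
theorem exchange_le (P Q P' Q' : PAut.{u} I E) :
    SimLE ((P.par Q).seq (P'.par Q')) ((P.seq P').par (Q.seq Q')) := by
  refine .of_kernel (fun s => StdSimplex.single (Sum.elim (Prod.map Sum.inl Sum.inl)
    (Prod.map Sum.inr Sum.inr) s)) ?_ ?_ ?_
  · simpa [seq_init, par_init] using Weak.refl _
  · rintro _ a _ ((⟨ha, hx, hy⟩ | ⟨ha, hx⟩ | ⟨ha, hy⟩) | (⟨ha, hx, hy⟩ | ⟨ha, hx⟩ | ⟨ha, hy⟩) |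
      @⟨⟨x, y⟩, hx, hy⟩)
    · simpa using WeakStep.of_trans
        (par_trans_sync ha (seq_trans_inl P P' _ _ _ hx) (seq_trans_inl Q Q' _ _ _ hy))
    · simpa using WeakStep.of_trans
        (par_trans_left (Q := Q.seq Q') ha (seq_trans_inl P P' _ _ _ hx) (Sum.inl _))
    · simpa using WeakStep.of_trans
        (par_trans_right (P := P.seq P') ha (seq_trans_inl Q Q' _ _ _ hy) (Sum.inl _))
    · simpa using WeakStep.of_trans
        (par_trans_sync ha (seq_trans_inr P P' _ _ _ hx) (seq_trans_inr Q Q' _ _ _ hy))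
    · simpa using WeakStep.of_trans
        (par_trans_left (Q := Q.seq Q') ha (seq_trans_inr P P' _ _ _ hx) (Sum.inr _))
    · simpa using WeakStep.of_trans
        (par_trans_right (P := P.seq P') ha (seq_trans_inr Q Q' _ _ _ hy) (Sum.inr _))
    · have h₁ := (Weak.of_trans (seq_trans_pass hx P')).par_left (Q := Q.seq Q')
        (StdSimplex.single (Sum.inl y))
      have h₂ := (Weak.of_trans (seq_trans_pass hy Q')).par_right (P := P.seq P')
        (P'.init.bind fun z => StdSimplex.single (Sum.inr z))
      simpa [par_init] using (h₁.trans h₂).weakStep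
  · rintro _ ⟨⟨x, y⟩, ⟨hx, hy⟩, rfl⟩
    exact .of_mem ⟨⟨x, hx, rfl⟩, ⟨y, hy, rfl⟩⟩

theorem choice_par_le (p : unitInterval) (P Q R : PAut.{u} I E) :
    SimLE (choice p (P.par Q) (P.par R)) (P.par (choice p Q R)) := by
  refine .of_map (Sum.elim (Prod.map id Sum.inl) (Prod.map id Sum.inr))
    (by simp [choice_init, par_init]) ?_ ?_
  · rintro _ a _ ((⟨ha, hx, hy⟩ | ⟨ha, hx⟩ | ⟨ha, hy⟩) | (⟨ha, hx, hy⟩ | ⟨ha, hx⟩ | ⟨ha, hy⟩))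
    · simpa using par_trans_sync ha hx (choice_trans_inl p Q R _ _ _ hy)
    · simpa using par_trans_left (Q := choice p Q R) ha hx (Sum.inl _)
    · simpa using par_trans_right ha (choice_trans_inl p Q R _ _ _ hy) _
    · simpa using par_trans_sync ha hx (choice_trans_inr p Q R _ _ _ hy)
    · simpa using par_trans_left (Q := choice p Q R) ha hx (Sum.inr _)
    · simpa using par_trans_right ha (choice_trans_inr p Q R _ _ _ hy) _
  · rintro _ (⟨s, hs, rfl⟩ | ⟨s, hs, rfl⟩)
    exacts [⟨hs.1, Or.inl ⟨_, hs.2, rfl⟩⟩, ⟨hs.1, Or.inr ⟨_, hs.2, rfl⟩⟩]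

/-- The choice is resolved in the initial distribution, before any step, so the states on both sides
correspond by distributing the product over the disjoint union. -/
theorem par_choice_le (p : unitInterval) (P Q R : PAut.{u} I E) :
    SimLE (P.par (choice p Q R)) (choice p (P.par Q) (P.par R)) := by
  refine .of_map (fun s => Sum.map (Prod.mk s.1) (Prod.mk s.1) s.2)
    (by simp [choice_init, par_init]) ?_ ?_
  · rintro _ a _ (⟨ha, hx, hy | hy⟩ | @⟨x, y | y, _, μ, ha, hx⟩ | ⟨ha, hy | hy⟩)
    · simpa using choice_trans_inl p (P.par Q) (P.par R) _ _ _ (par_trans_sync ha hx hy)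
    · simpa using choice_trans_inr p (P.par Q) (P.par R) _ _ _ (par_trans_sync ha hx hy)
    · simpa using choice_trans_inl p (P.par Q) (P.par R) _ _ _ (par_trans_left ha hx y)
    · simpa using choice_trans_inr p (P.par Q) (P.par R) _ _ _ (par_trans_left ha hx y)
    · simpa using choice_trans_inl p (P.par Q) (P.par R) _ _ _ (par_trans_right ha hy _)
    · simpa using choice_trans_inr p (P.par Q) (P.par R) _ _ _ (par_trans_right ha hy _)
  · rintro ⟨x, _⟩ ⟨hx, ⟨y, hy, rfl⟩ | ⟨y, hy, rfl⟩⟩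
    exacts [Or.inl ⟨_, ⟨hx, hy⟩, rfl⟩, Or.inr ⟨_, ⟨hx, hy⟩, rfl⟩]

/-! ### The quotient -/

theorem SimEquiv.refl (P : PAut.{u} I E) : SimEquiv P P := ⟨.refl P, .refl P⟩

/-- Simulation equivalence as a setoid. -/
def simSetoid (I : Type v) (E : Type w) : Setoid (PAut.{u} I E) where
  r := SimEquiv
  iseqv := ⟨SimEquiv.refl, fun h => ⟨h.2, h.1⟩, fun h h' => ⟨h.1.trans h'.1, h'.2.trans h.2⟩⟩

theorem add_equiv_right_iff : SimEquiv (P.add Q) Q ↔ SimLE P Q :=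
  ⟨fun h => (le_add_left P Q).trans h.1, fun h => ⟨add_le h (.refl Q), le_add_right P Q⟩⟩

theorem add_comm_le (P Q : PAut.{u} I E) : SimLE (P.add Q) (Q.add P) :=
  add_le (le_add_right Q P) (le_add_left Q P)

theorem mk_eq_iff : Quotient.mk (simSetoid I E) P = Quotient.mk _ Q ↔ SimEquiv P Q :=
  Quotient.eq

/-- The probabilistic concurrent Kleene algebra of automata up to simulation equivalence. -/
instance : ProbConcurrentKleeneAlgebra (Quotient (simSetoid.{u} I E)) where
  add := Quotient.map₂ add fun _ _ h _ _ h' => ⟨add_mono h.1 h'.1, add_mono h.2 h'.2⟩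
  mul := Quotient.map₂ seq fun _ _ h _ _ h' => ⟨seq_mono h.1 h'.1, seq_mono h.2 h'.2⟩
  zero := Quotient.mk _ deadlock
  one := Quotient.mk _ skip
  par := Quotient.map₂ par fun _ _ h _ _ h' => ⟨par_mono h.1 h'.1, par_mono h.2 h'.2⟩
  star := Quotient.map star fun _ _ h => ⟨star_mono h.1, star_mono h.2⟩
  choice p := Quotient.map₂ (choice p) fun _ _ h _ _ h' =>
    ⟨choice_mono p h.1 h'.1, choice_mono p h.2 h'.2⟩
  add_idem := by
    rintro ⟨P⟩
    exact mk_eq_iff.2 ⟨le_add_left P P, add_le (.refl P) (.refl P)⟩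
  add_deadlock := by
    rintro ⟨P⟩
    exact mk_eq_iff.2 ⟨le_add_left P _, add_le (.refl P) (deadlock_le P)⟩
  add_comm := by
    rintro ⟨P⟩ ⟨Q⟩
    exact mk_eq_iff.2 ⟨add_comm_le P Q, add_comm_le Q P⟩
  add_assoc := by
    rintro ⟨P⟩ ⟨Q⟩ ⟨R⟩
    refine mk_eq_iff.2 ⟨add_le ?_ (add_le ?_ ?_), add_le (add_le ?_ ?_) ?_⟩
    · exact (le_add_left P Q).trans (le_add_left _ R)
    · exact (le_add_right P Q).trans (le_add_left _ R)
    · exact le_add_right _ R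
    · exact le_add_left P _
    · exact (le_add_left Q R).trans (le_add_right P _)
    · exact (le_add_right Q R).trans (le_add_right P _)
  mul_skip := by
    rintro ⟨P⟩
    exact mk_eq_iff.2 ⟨le_seq_skip P, seq_skip_le P⟩
  skip_mul := by
    rintro ⟨P⟩
    exact mk_eq_iff.2 ⟨le_skip_seq P, skip_seq_le P⟩
  deadlock_mul := by
    rintro ⟨P⟩
    exact mk_eq_iff.2 ⟨deadlock_le _, deadlock_seq_le P⟩
  mul_assoc := by
    rintro ⟨P⟩ ⟨Q⟩ ⟨R⟩
    exact mk_eq_iff.2 ⟨seq_assoc_le P Q R, seq_assoc_ge P Q R⟩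
  add_mul := by
    rintro ⟨P⟩ ⟨Q⟩ ⟨R⟩
    exact mk_eq_iff.2 ⟨add_le (seq_mono (le_add_left P Q) (.refl R))
      (seq_mono (le_add_right P Q) (.refl R)), add_seq_le P Q R⟩
  mul_add_sub := by
    rintro ⟨P⟩ ⟨Q⟩ ⟨R⟩
    exact mk_eq_iff.2 <| add_equiv_right_iff.2 <| add_le (seq_mono (.refl P) (le_add_left Q R))
      (seq_mono (.refl P) (le_add_right Q R))
  star_unfold := by
    rintro ⟨P⟩
    exact mk_eq_iff.2 ⟨star_le_skip_add_seq_star P, skip_add_seq_star_le_star P⟩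
  star_induction := by
    rintro ⟨P⟩ ⟨Q⟩ h
    exact mk_eq_iff.2 <| add_equiv_right_iff.2 <| star_seq_le <|
      add_equiv_right_iff.1 <| mk_eq_iff.1 h
  par_comm := by
    rintro ⟨P⟩ ⟨Q⟩
    exact mk_eq_iff.2 ⟨par_comm_le P Q, par_comm_le Q P⟩
  par_assoc := by
    rintro ⟨P⟩ ⟨Q⟩ ⟨R⟩
    exact mk_eq_iff.2 ⟨par_assoc_le P Q R, par_assoc_ge P Q R⟩
  exchange := by
    rintro ⟨P⟩ ⟨Q⟩ ⟨P'⟩ ⟨Q'⟩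
    exact mk_eq_iff.2 <| add_equiv_right_iff.2 <| exchange_le P Q P' Q'
  par_add_sub := by
    rintro ⟨P⟩ ⟨Q⟩ ⟨R⟩
    exact mk_eq_iff.2 <| add_equiv_right_iff.2 <| add_le (par_mono (.refl P) (le_add_left Q R))
      (par_mono (.refl P) (le_add_right Q R))
  choice_idem := by
    rintro p ⟨P⟩
    exact mk_eq_iff.2 ⟨le_choice_self p P, choice_self_le p P⟩
  choice_comm := by
    rintro p ⟨P⟩ ⟨Q⟩
    refine mk_eq_iff.2 ⟨choice_symm_le p P Q, ?_⟩
    simpa using choice_symm_le (unitInterval.symm p) Q P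
  choice_assoc := by
    rintro p q p' q' ⟨P⟩ ⟨Q⟩ ⟨R⟩ h₁ h₂ h₃
    exact mk_eq_iff.2 ⟨choice_assoc_le h₁ h₂ h₃ P Q R, choice_assoc_ge h₁ h₂ h₃ P Q R⟩
  choice_mul := by
    rintro p ⟨P⟩ ⟨Q⟩ ⟨R⟩
    exact mk_eq_iff.2 ⟨choice_seq_le p P Q R, choice_seq_ge p P Q R⟩
  mul_choice_sub := by
    rintro p ⟨P⟩ ⟨Q⟩ ⟨R⟩
    exact mk_eq_iff.2 <| add_equiv_right_iff.2 <| seq_choice_le p P Q R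
  par_choice := by
    rintro p ⟨P⟩ ⟨Q⟩ ⟨R⟩
    exact mk_eq_iff.2 ⟨choice_par_le p P Q R, par_choice_le p P Q R⟩

end PAut

end

theorem mainTheorem1 (I : Type v) (E : Type w) :
    ∃ (s : Setoid (PAut.{u} I E)) (_ : ProbConcurrentKleeneAlgebra (Quotient s)),
      (∀ P Q : PAut.{u} I E, s P Q ↔ PAut.SimEquiv P Q) ∧
      (∀ P Q : PAut.{u} I E,
        (Quotient.mk s P + Quotient.mk s Q = Quotient.mk s Q ↔ PAut.SimLE P Q)) ∧
      Quotient.mk s PAut.deadlock = 0 ∧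
      Quotient.mk s PAut.skip = 1 ∧
      (∀ P Q : PAut.{u} I E, Quotient.mk s (P.add Q) = Quotient.mk s P + Quotient.mk s Q) ∧
      (∀ P Q : PAut.{u} I E, Quotient.mk s (P.seq Q) = Quotient.mk s P * Quotient.mk s Q) ∧
      (∀ P Q : PAut.{u} I E, Quotient.mk s (P.par Q) =
        WeakConcurrentKleeneAlgebra.par (Quotient.mk s P) (Quotient.mk s Q)) ∧
      (∀ P : PAut.{u} I E,
        Quotient.mk s P.star = WeakConcurrentKleeneAlgebra.star (Quotient.mk s P)) ∧
      (∀ (p : unitInterval) (P Q : PAut.{u} I E), Quotient.mk s (PAut.choice p P Q) =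
        ProbConcurrentKleeneAlgebra.choice p (Quotient.mk s P) (Quotient.mk s Q)) :=
  ⟨PAut.simSetoid I E, inferInstance, fun _ _ => Iff.rfl,
    fun _ _ => PAut.mk_eq_iff.trans PAut.add_equiv_right_iff, rfl, rfl, fun _ _ => rfl,
    fun _ _ => rfl, fun _ _ => rfl, fun _ => rfl, fun _ _ _ => rfl⟩
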